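/- For an integer $k\ge 2$, let $J_k(\mathbb{Z})$ be the group, under composition, of all formal power series $f=x+\sum_{i\ge k}\alpha_i x^i\in\mathbb{Z}[[x]]$. Write $H_1(J_k(\mathbb{Z}))=J_k(\mathbb{Z})/[J_k(\mathbb{Z}),J_k(\mathbb{Z})]$ for its abelianization and $T(H_1(J_k(\mathbb{Z})))$ for the subgroup of elements of finite order in it. Theorem. Let $k\ge 5$. (a) If $k\equiv 3\pmod 4$, then $T(H_1(J_k(\mathbb{Z})))\cong(\mathbb{Z}/2\mathbb{Z})^{(k+1)/2}$. (b) If $k\equiv 2\pmod 4$, then $T(H_1(J_k(\mathbb{Z})))\cong(\mathbb{Z}/2\mathbb{Z})^{(k+2)/2}$. (c) If $k\equiv 1\pmod 4$, then $T(H_1(J_k(\mathbb{Z})))\cong\mathbb{Z}/4\mathbb{Z}\oplus(\mathbb{Z}/2\mathbb{Z})^{(k-3)/2}$. (d) If $k\equiv 0\pmod 4$, then $T(H_1(J_k(\mathbb{Z})))\cong\mathbb{Z}/4\mathbb{Z}\oplus(\mathbb{Z}/2\mathbb{Z})^{(k-2)/2}$. -/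

import Mathlib

/-- The Jennings group `J(R)` of a commutative ring `R`: the formal power series
`f = x + α₂ x² + α₃ x³ + ⋯` with coefficients in `R`, as a set.
Its group law, given below, is composition. -/
@[ext]
structure JenningsGroup (R : Type*) [CommRing R] where
  /-- the underlying power series -/
  toSeries : PowerSeries R
  coeff_zero : PowerSeries.coeff 0 toSeries = 0
  coeff_one : PowerSeries.coeff 1 toSeries = 1

namespace JenningsGroup

variable {R : Type*} [CommRing R]

theorem hasSubst (f : JenningsGroup R) : PowerSeries.HasSubst f.toSeries :=
  PowerSeries.HasSubst.of_constantCoeff_zero' (by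
    rw [← PowerSeries.coeff_zero_eq_constantCoeff_apply]; exact f.coeff_zero)

theorem X_dvd (f : JenningsGroup R) : PowerSeries.X ∣ f.toSeries := by
  rw [PowerSeries.X_dvd_iff, ← PowerSeries.coeff_zero_eq_constantCoeff_apply]
  exact f.coeff_zero

theorem X_sq_dvd (f : JenningsGroup R) :
    (PowerSeries.X : PowerSeries R) ^ 2 ∣ f.toSeries - PowerSeries.X := by
  rw [PowerSeries.X_pow_dvd_iff]
  intro m hm
  interval_cases m
  · simpa using f.coeff_zero
  · simp [f.coeff_one]

/-- If `f = x + O(x^k)`, then `f ∘ g = g + O(x^k)`. -/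
theorem X_pow_dvd_subst_sub {k : ℕ} {f : PowerSeries R} (g : JenningsGroup R)
    (hf : (PowerSeries.X : PowerSeries R) ^ k ∣ f - PowerSeries.X) :
    (PowerSeries.X : PowerSeries R) ^ k ∣ PowerSeries.subst g.toSeries f - g.toSeries := by
  obtain ⟨u, hu⟩ := hf
  have h : PowerSeries.subst g.toSeries f - g.toSeries
      = g.toSeries ^ k * PowerSeries.subst g.toSeries u := by
    have h2 := congrArg (PowerSeries.subst g.toSeries) hu
    rw [PowerSeries.subst_sub g.hasSubst, PowerSeries.subst_mul g.hasSubst,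
      PowerSeries.subst_pow g.hasSubst, PowerSeries.subst_X g.hasSubst] at h2
    exact h2
  rw [h]
  exact Dvd.dvd.mul_right (pow_dvd_pow_of_dvd g.X_dvd k) _

/-- A series is in `J(R)` as soon as it is congruent to `x` modulo `x²`. -/
def ofDvd (f : PowerSeries R)
    (hf : (PowerSeries.X : PowerSeries R) ^ 2 ∣ f - PowerSeries.X) : JenningsGroup R where
  toSeries := f
  coeff_zero := by
    have := PowerSeries.X_pow_dvd_iff.1 hf 0 (by norm_num)
    simpa using this
  coeff_one := by
    have := PowerSeries.X_pow_dvd_iff.1 hf 1 (by norm_num)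
    simpa [sub_eq_zero] using this

/-- The product `f * g` is the composition `f ∘ g`, that is, `f(g(x))`. -/
noncomputable instance : Mul (JenningsGroup R) where
  mul f g := ofDvd (PowerSeries.subst g.toSeries f.toSeries) (by
    have h := dvd_add (X_pow_dvd_subst_sub g f.X_sq_dvd) g.X_sq_dvd
    rwa [sub_add_sub_cancel] at h)

/-- The identity is the series `x`. -/
noncomputable instance : One (JenningsGroup R) where
  one := ofDvd PowerSeries.X (by simp)

theorem isUnit_coeff_one (f : JenningsGroup R) : IsUnit (PowerSeries.coeff 1 f.toSeries) := by
  rw [f.coeff_one]; exact isUnit_one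

/-- The inverse of `f` is its compositional inverse. -/
noncomputable instance : Inv (JenningsGroup R) where
  inv f :=
    { toSeries := PowerSeries.substInvOfIsUnit f.toSeries f.isUnit_coeff_one
      coeff_zero := by
        rw [PowerSeries.coeff_zero_eq_constantCoeff_apply]
        exact PowerSeries.constantCoeff_substInvOfIsUnit _ _
      coeff_one := by
        have h : f.isUnit_coeff_one.unit = 1 := Units.ext f.coeff_one
        rw [PowerSeries.coeff_one_substInvOfIsUnit, h, inv_one, Units.val_one] }

theorem toSeries_mul (f g : JenningsGroup R) :
    (f * g).toSeries = PowerSeries.subst g.toSeries f.toSeries := rfl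

theorem toSeries_one : (1 : JenningsGroup R).toSeries = PowerSeries.X := rfl

theorem toSeries_inv (f : JenningsGroup R) :
    (f⁻¹).toSeries = PowerSeries.substInvOfIsUnit f.toSeries f.isUnit_coeff_one := rfl

noncomputable instance : Group (JenningsGroup R) :=
  Group.ofLeftAxioms
    (fun f g h => by
      ext1
      simp only [toSeries_mul]
      exact (PowerSeries.subst_comp_subst_apply g.hasSubst h.hasSubst f.toSeries))
    (fun f => by
      ext1
      rw [toSeries_mul, toSeries_one, PowerSeries.subst_X f.hasSubst])
    (fun f => by
      ext1
      rw [toSeries_mul, toSeries_one, toSeries_inv]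
      exact PowerSeries.subst_substInvOfIsUnit_left _
        (by rw [← PowerSeries.coeff_zero_eq_constantCoeff_apply]; exact f.coeff_zero) _)

theorem coeff_eq_zero_iff_dvd (k : ℕ) (f : JenningsGroup R) :
    (∀ i, 2 ≤ i → i < k → PowerSeries.coeff i f.toSeries = 0) ↔
      (PowerSeries.X : PowerSeries R) ^ k ∣ f.toSeries - PowerSeries.X := by
  rw [PowerSeries.X_pow_dvd_iff]
  constructor
  · intro h m hm
    rcases Nat.lt_or_ge m 2 with h2 | h2
    · exact PowerSeries.X_pow_dvd_iff.1 f.X_sq_dvd m h2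
    · rw [map_sub, h m h2 hm, PowerSeries.coeff_X, if_neg (by omega), sub_zero]
  · intro h i h2 hi
    have := h i hi
    rwa [map_sub, PowerSeries.coeff_X, if_neg (by omega), sub_zero] at this

/-- The subgroup `J_k(R)` of `J(R)`: the series `x + ∑_{i ≥ k} αᵢ xⁱ`. -/
def level (R : Type*) [CommRing R] (k : ℕ) : Subgroup (JenningsGroup R) where
  carrier := {f | ∀ i, 2 ≤ i → i < k → PowerSeries.coeff i f.toSeries = 0}
  one_mem' := (coeff_eq_zero_iff_dvd k 1).2 (by rw [toSeries_one, sub_self]; exact dvd_zero _)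
  mul_mem' := by
    intro f g hf hg
    refine (coeff_eq_zero_iff_dvd k (f * g)).2 ?_
    have h := dvd_add (X_pow_dvd_subst_sub g ((coeff_eq_zero_iff_dvd k f).1 hf))
      ((coeff_eq_zero_iff_dvd k g).1 hg)
    rwa [sub_add_sub_cancel] at h
  inv_mem' := by
    intro f hf
    refine (coeff_eq_zero_iff_dvd k f⁻¹).2 ?_
    have h := X_pow_dvd_subst_sub f⁻¹ ((coeff_eq_zero_iff_dvd k f).1 hf)
    rw [← toSeries_mul, mul_inv_cancel, toSeries_one] at h
    exact (dvd_sub_comm).1 h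

end JenningsGroup

/-! Put `d = k - 1`, so that the group is G = `filt ℤ d`, and say that a series x + O(x^(m+1)) has
depth at least m. Commutators in G have depth at least 2d+1. Raising a series of depth m to the n-th
power multiplies its leading coefficient by n, so a torsion class of the abelianization is
represented in depth at least 2d+1. Once the image of `filt ℤ (2 * d + 1)` is known to be finite, it
is therefore exactly the torsion (`range_toAb_eq_torsion`).

Upper bound. The commutator of x + r x^(a+1) and x + s x^(e+1) has leading coefficient (a-e)rs at
depth a+e. Products of two such commutators give every leading coefficient at odd depth and every
even one at even depth (`exists_linear`). When the leading terms cancel, a second-order term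
containing the binomial coefficient of e+1 over 2 survives. It is odd for e ≡ 2 mod 4, so G' also
reaches leading coefficient one at all even depths from 3d+6 on and at a few slightly smaller ones
(`Good`). By completeness every series of depth at least 3d+9 lies in G' (`filt_le_commutator`).
Each remaining depth costs at most a factor two.

Lower bound. On depth at least 2d+1 the coefficients of index at most 4d+2 are additive, and it
remains to find combinations of them that kill commutators. Over ℤ a commutator is a Wronskian up to
depth 3d. In characteristic two f' is a square φ(f)^2, and the chain rule makes φ = `halfDeriv` a
multiplicative cocycle, which determines odd-index coefficients modulo two up to index about 4d.
Comparing the two descriptions gives invariants modulo two. For d ≡ 0, 3 mod 4 one integral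
coefficient is, modulo four, twice a determinant that reappears modulo two at a larger index, whence
an invariant modulo four. The invariants take as many values as the upper bound allows, so
`nonempty_torsion_equiv` concludes. -/

namespace JenningsGroup

open PowerSeries
open scoped commutatorElement

variable {R : Type*} [CommRing R]

/-! ### Depth filtration and Taylor expansion -/

/-- The subgroup of series `x + O(x ^ (n + 1))`. -/
abbrev filt (R : Type*) [CommRing R] (n : ℕ) : Subgroup (JenningsGroup R) := level R (n + 1)

theorem mem_filt {n : ℕ} {f : JenningsGroup R} :
    f ∈ filt R n ↔ (X : R⟦X⟧) ^ (n + 1) ∣ f.toSeries - X :=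
  coeff_eq_zero_iff_dvd (n + 1) f

theorem filt_anti {m n : ℕ} (h : m ≤ n) : filt R n ≤ filt R m := by
  intro f hf
  rw [mem_filt] at hf ⊢
  exact (pow_dvd_pow _ (by omega)).trans hf

theorem X_pow_dvd_subst {m : ℕ} {P : R⟦X⟧} (g : JenningsGroup R) (h : (X : R⟦X⟧) ^ m ∣ P) :
    (X : R⟦X⟧) ^ m ∣ P.subst g.toSeries := by
  obtain ⟨Q, rfl⟩ := h
  rw [subst_mul g.hasSubst, subst_pow g.hasSubst, subst_X g.hasSubst]
  exact Dvd.dvd.mul_right (pow_dvd_pow_of_dvd g.X_dvd m) _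

theorem subst_toSeries_mul (P : R⟦X⟧) (f g : JenningsGroup R) :
    subst (f * g).toSeries P = subst g.toSeries (subst f.toSeries P) := by
  rw [toSeries_mul, subst_comp_subst_apply f.hasSubst g.hasSubst]

/-- Composition with `g` is invertible, so it preserves the order of vanishing. This lets the change
of variable be stripped from commutator identities. -/
theorem X_pow_dvd_subst_iff {m : ℕ} {P : R⟦X⟧} (g : JenningsGroup R) :
    (X : R⟦X⟧) ^ m ∣ P.subst g.toSeries ↔ (X : R⟦X⟧) ^ m ∣ P := by
  refine ⟨fun h => ?_, X_pow_dvd_subst g⟩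
  have h2 := X_pow_dvd_subst g⁻¹ h
  rwa [← subst_toSeries_mul, mul_inv_cancel, toSeries_one, X_subst] at h2

theorem exists_one_add_pow_eq (w : R⟦X⟧) (n : ℕ) :
    ∃ k : R⟦X⟧, (1 + w) ^ n = 1 + n * w + n.choose 2 * w ^ 2 + k * w ^ 3 := by
  induction n with
  | zero => exact ⟨0, by simp⟩
  | succ n ih =>
    obtain ⟨k, hk⟩ := ih
    refine ⟨k + k * w + n.choose 2, ?_⟩
    rw [pow_succ, hk, Nat.choose_succ_succ' n 1]
    push_cast
    simp only [Nat.choose_one_right]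
    ring

theorem exists_toSeries_eq {n : ℕ} {g : JenningsGroup R} (hg : g ∈ filt R n) :
    ∃ w : R⟦X⟧, g.toSeries = X * (1 + w) ∧ (X : R⟦X⟧) ^ n ∣ w := by
  rw [mem_filt] at hg
  obtain ⟨w, hw⟩ := hg
  exact ⟨X ^ n * w, by linear_combination hw, Dvd.intro _ rfl⟩

theorem subst_C_mul (g : JenningsGroup R) (c : R) (P : R⟦X⟧) :
    (C c * P).subst g.toSeries = C c * P.subst g.toSeries := by
  rw [← smul_eq_C_mul, subst_smul g.hasSubst, smul_eq_C_mul]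

theorem X_pow_dvd_derivative {m : ℕ} {P : R⟦X⟧} (h : (X : R⟦X⟧) ^ m ∣ P) :
    (X : R⟦X⟧) ^ m ∣ X * d⁄dX R P := by
  obtain ⟨Q, rfl⟩ := h
  rw [Derivation.leibniz, derivative_pow, derivative_X]
  rcases m with _ | m
  · simp
  · exact ⟨((m : R⟦X⟧) + 1) * Q + X * d⁄dX R Q, by simp; ring⟩

/-- Taylor expansion to first order, with remainder. -/
theorem taylor {m n : ℕ} {P : R⟦X⟧} {g : JenningsGroup R} (hg : g ∈ filt R n)
    (hP : (X : R⟦X⟧) ^ m ∣ P) :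
    (X : R⟦X⟧) ^ (m + 2 * n) ∣
      P.subst g.toSeries - P - d⁄dX R P * (g.toSeries - X) := by
  -- Truncate at order `L` and peel off the lowest monomial of `P` repeatedly; `j` counts the
  -- coefficients below order `L` still to be treated. Each monomial is handled by the binomial
  -- theorem.
  suffices H : ∀ L j m, m + j = L → ∀ P : R⟦X⟧, X ^ m ∣ P → (X : R⟦X⟧) ^ min L (m + 2 * n) ∣
      P.subst g.toSeries - P - d⁄dX R P * (g.toSeries - X) by
    simpa using H (m + 2 * n) (2 * n) m rfl P hP
  have hgX := mem_filt.1 hg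
  intro L j
  induction j with
  | zero =>
    intro m hm P hP
    have h1 : (X : R⟦X⟧) ^ m ∣ d⁄dX R P * (g.toSeries - X) := by
      obtain ⟨q, hq⟩ := (show (X : R⟦X⟧) ^ 1 ∣ g.toSeries - X from
        (pow_dvd_pow _ (by omega)).trans hgX)
      obtain ⟨p, hp⟩ := X_pow_dvd_derivative hP
      exact ⟨p * q, by rw [hq]; linear_combination q * hp⟩
    exact (pow_dvd_pow _ (by omega)).trans (dvd_sub (dvd_sub (X_pow_dvd_subst g hP) hP) h1)
  | succ j ih =>
    intro m hm P hP
    obtain ⟨Q, rfl⟩ := hP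
    obtain ⟨S, hS⟩ : (X : R⟦X⟧) ∣ Q - C (constantCoeff Q) := by
      rw [X_dvd_iff]; simp
    have hsplit : X ^ m * Q = C (constantCoeff Q) * X ^ m + X ^ (m + 1) * S := by
      linear_combination X ^ m * hS
    have h1 := ih (m + 1) (by omega) (X ^ (m + 1) * S) (Dvd.intro _ rfl)
    have h2 : (X : R⟦X⟧) ^ (m + 2 * n) ∣ (C (constantCoeff Q) * X ^ m : R⟦X⟧).subst g.toSeries
        - C (constantCoeff Q) * X ^ m
        - d⁄dX R (C (constantCoeff Q) * X ^ m) * (g.toSeries - X) := by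
      obtain ⟨w, hw, ⟨v, hv⟩⟩ := exists_toSeries_eq hg
      obtain ⟨k, hk⟩ := exists_one_add_pow_eq w m
      rw [subst_C_mul, subst_pow g.hasSubst, subst_X g.hasSubst, hw, mul_pow, hk,
        Derivation.leibniz, derivative_C, derivative_pow, derivative_X]
      refine ⟨C (constantCoeff Q) * (m.choose 2 + k * w) * v ^ 2, ?_⟩
      rcases m with _ | m
      · simp only [Nat.cast_zero, pow_zero, Nat.choose_zero_succ, hv, zero_mul, smul_zero]
        ring
      · simp only [Nat.add_sub_cancel, smul_eq_mul]
        rw [hv]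
        push_cast
        ring
    rw [hsplit, subst_add g.hasSubst, map_add]
    have h3 := dvd_add ((pow_dvd_pow _ (min_le_right L _)).trans h2)
      ((pow_dvd_pow _ (show min L (m + 2 * n) ≤ min L (m + 1 + 2 * n) by omega)).trans h1)
    convert h3 using 1
    ring

theorem X_pow_dvd_subst_sub_self {m n : ℕ} {P : R⟦X⟧} {g : JenningsGroup R}
    (hg : g ∈ filt R n) (hP : (X : R⟦X⟧) ^ m ∣ P) :
    (X : R⟦X⟧) ^ (m + n) ∣ P.subst g.toSeries - P := by
  have h1 := (pow_dvd_pow _ (show m + n ≤ m + 2 * n by omega)).trans (taylor hg hP)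
  have h2 : (X : R⟦X⟧) ^ (m + n) ∣ d⁄dX R P * (g.toSeries - X) := by
    obtain ⟨q, hq⟩ := mem_filt.1 hg
    obtain ⟨p, hp⟩ := X_pow_dvd_derivative hP
    exact ⟨p * q, by rw [hq]; linear_combination X ^ n * q * hp⟩
  simpa using dvd_add h1 h2

theorem mul_inv_mem_filt_iff {n : ℕ} {f g : JenningsGroup R} :
    f * g⁻¹ ∈ filt R n ↔ (X : R⟦X⟧) ^ (n + 1) ∣ f.toSeries - g.toSeries := by
  rw [mem_filt, ← X_pow_dvd_subst_iff g (P := (f * g⁻¹).toSeries - X), subst_sub g.hasSubst,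
    ← toSeries_mul, inv_mul_cancel_right, subst_X g.hasSubst]

instance filt_normal (n : ℕ) : (filt R n).Normal where
  conj_mem f hf g := by
    rw [mul_inv_mem_filt_iff, toSeries_mul]
    rw [add_comm]
    exact X_pow_dvd_subst_sub_self hf (by simpa using g.X_dvd)

theorem toSeries_mul_sub_X (f g : JenningsGroup R) :
    (f * g).toSeries - X = (f.toSeries - X).subst g.toSeries + (g.toSeries - X) := by
  rw [toSeries_mul, subst_sub g.hasSubst, subst_X g.hasSubst]
  ring

/-! ### Expansions of commutators -/

/-- A commutator is determined by the equation `⁅f, g⁆ ∘ (g ∘ f) = f ∘ g`. -/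
theorem commutator_congr {m : ℕ} {f g : JenningsGroup R} {T : R⟦X⟧}
    (h : (X : R⟦X⟧) ^ m ∣ T.subst (g * f).toSeries -
      (((f.toSeries - X).subst g.toSeries - (f.toSeries - X)) -
        ((g.toSeries - X).subst f.toSeries - (g.toSeries - X)))) :
    (X : R⟦X⟧) ^ m ∣ ⁅f, g⁆.toSeries - X - T := by
  rw [← X_pow_dvd_subst_iff (g * f), subst_sub (g * f).hasSubst, subst_sub (g * f).hasSubst,
    subst_X (g * f).hasSubst, ← toSeries_mul]
  have e : ⁅f, g⁆ * (g * f) = f * g := by rw [commutatorElement_def]; group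
  rw [e]
  have h1 := toSeries_mul_sub_X f g
  have h2 := toSeries_mul_sub_X g f
  have h3 := (dvd_neg (α := R⟦X⟧)).2 h
  convert h3 using 1
  linear_combination h1 - h2

theorem commutator_mem_filt_add {a b : ℕ} {f g : JenningsGroup R} (hf : f ∈ filt R a)
    (hg : g ∈ filt R b) : ⁅f, g⁆ ∈ filt R (a + b) := by
  rw [mem_filt]
  have h := commutator_congr (m := a + b + 1) (f := f) (g := g) (T := 0) (by
    rw [← coe_substAlgHom (g * f).hasSubst, map_zero, zero_sub, dvd_neg]
    refine dvd_sub ?_ ?_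
    · exact (pow_dvd_pow _ (by omega)).trans (X_pow_dvd_subst_sub_self hg (mem_filt.1 hf))
    · exact (pow_dvd_pow _ (by omega)).trans (X_pow_dvd_subst_sub_self hf (mem_filt.1 hg)))
  simpa using h

/-- The commutator of two series of depth at least `d`, up to terms of depth `3 * d`. -/
theorem commutator_wronskian {d : ℕ} {f g : JenningsGroup R} (hf : f ∈ filt R d)
    (hg : g ∈ filt R d) :
    (X : R⟦X⟧) ^ (3 * d + 1) ∣ ⁅f, g⁆.toSeries - X -
      (d⁄dX R (f.toSeries - X) * (g.toSeries - X) -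
        d⁄dX R (g.toSeries - X) * (f.toSeries - X)) := by
  apply commutator_congr
  have hT : (X : R⟦X⟧) ^ (2 * d + 1) ∣ (d⁄dX R (f.toSeries - X) * (g.toSeries - X) -
        d⁄dX R (g.toSeries - X) * (f.toSeries - X)) := by
    obtain ⟨p, hp⟩ := mem_filt.1 hf
    obtain ⟨q, hq⟩ := mem_filt.1 hg
    obtain ⟨p', hp'⟩ := X_pow_dvd_derivative (mem_filt.1 hf)
    obtain ⟨q', hq'⟩ := X_pow_dvd_derivative (mem_filt.1 hg)
    refine ⟨p' * q - q' * p, ?_⟩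
    rw [show d⁄dX R (f.toSeries - X) * (g.toSeries - X) =
      (X * d⁄dX R (f.toSeries - X)) * (X ^ d * q) by rw [hq]; ring,
      show d⁄dX R (g.toSeries - X) * (f.toSeries - X) =
      (X * d⁄dX R (g.toSeries - X)) * (X ^ d * p) by rw [hp]; ring, hp', hq']
    ring
  have h1 := X_pow_dvd_subst_sub_self (mul_mem hg hf) hT
  have h2 := taylor hg (mem_filt.1 hf)
  have h3 := taylor hf (mem_filt.1 hg)
  rw [show 2 * d + 1 + d = 3 * d + 1 by ring] at h1
  rw [show d + 1 + 2 * d = 3 * d + 1 by ring] at h2 h3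
  refine (Eq.mp (congrArg _ ?_) (dvd_add (dvd_sub h1 h2) h3))
  ring

/-- One more than the general bound: for equal depths the leading terms of the Wronskian cancel by
antisymmetry. -/
theorem commutator_mem_filt {d : ℕ} (hd : 1 ≤ d) {f g : JenningsGroup R} (hf : f ∈ filt R d)
    (hg : g ∈ filt R d) : ⁅f, g⁆ ∈ filt R (2 * d + 1) := by
  have h := (pow_dvd_pow _ (show 2 * d + 1 + 1 ≤ 3 * d + 1 by omega)).trans
    (commutator_wronskian hf hg)
  rw [mem_filt]
  obtain ⟨p, hp⟩ := mem_filt.1 hf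
  obtain ⟨q, hq⟩ := mem_filt.1 hg
  refine (dvd_sub_left ?_).1 h
  rw [hp, hq, Derivation.leibniz, Derivation.leibniz]
  exact ⟨d⁄dX R p * q - d⁄dX R q * p, by simp only [smul_eq_mul]; ring⟩

theorem commutator_filt_le {d : ℕ} (hd : 1 ≤ d) :
    ⁅filt R d, filt R d⁆ ≤ filt R (2 * d + 1) :=
  Subgroup.commutator_le.2 fun _ hf _ hg => commutator_mem_filt hd hf hg

theorem X_pow_dvd_mul_toSeries {m : ℕ} {f g : JenningsGroup R} (hf : f ∈ filt R m)
    (hg : g ∈ filt R m) : (X : R⟦X⟧) ^ (2 * m + 1) ∣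
      ((f * g).toSeries - X) - ((f.toSeries - X) + (g.toSeries - X)) := by
  rw [toSeries_mul_sub_X]
  convert X_pow_dvd_subst_sub_self hg (mem_filt.1 hf) using 1 <;> ring

theorem coeff_mul_of_mem_filt {m j : ℕ} {f g : JenningsGroup R} (hf : f ∈ filt R m)
    (hg : g ∈ filt R m) (hj : j ≤ 2 * m) (h2 : 2 ≤ j) : coeff j (f * g).toSeries =
      coeff j f.toSeries + coeff j g.toSeries := by
  have h := X_pow_dvd_iff.1 (X_pow_dvd_mul_toSeries hf hg) j (by omega)
  have hX : coeff j (X : R⟦X⟧) = 0 := by rw [coeff_X, if_neg (by omega)]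
  simp only [map_sub, map_add, hX] at h
  linear_combination h

/-- A series congruent to `x` modulo `x ^ 2`, as an element of the Jennings group. -/
theorem exists_toSeries_eq_X_add {n : ℕ} (hn : 1 ≤ n) (Q : R⟦X⟧) :
    ∃ f : JenningsGroup R, f.toSeries = X + X ^ (n + 1) * Q :=
  ⟨ofDvd (X + X ^ (n + 1) * Q) (by
    rw [add_sub_cancel_left]
    exact Dvd.dvd.mul_right (pow_dvd_pow _ (by omega)) _), rfl⟩

/-- The series `x + c x ^ (n + 1)`, for `n ≥ 1`. -/
noncomputable def mono (n : ℕ) (c : R) : JenningsGroup R :=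
  if hn : 1 ≤ n then (exists_toSeries_eq_X_add hn (C c)).choose else 1

theorem toSeries_mono {n : ℕ} (hn : 1 ≤ n) (c : R) :
    (mono n c).toSeries = X + X ^ (n + 1) * C c := by
  rw [mono, dif_pos hn]
  exact (exists_toSeries_eq_X_add hn (C c)).choose_spec

theorem mono_mem_filt {n : ℕ} (c : R) : mono n c ∈ filt R n := by
  by_cases hn : 1 ≤ n
  · rw [mem_filt, toSeries_mono hn, add_sub_cancel_left]
    exact Dvd.intro _ rfl
  · rw [mono, dif_neg hn]
    exact one_mem _

theorem coeff_mono {n m : ℕ} (hn : 1 ≤ n) (c : R) (hm : 2 ≤ m) :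
    coeff m (mono n c).toSeries = if m = n + 1 then c else 0 := by
  rw [toSeries_mono hn, map_add, coeff_X, if_neg (by omega), zero_add, mul_comm, coeff_C_mul,
    coeff_X_pow]
  split_ifs <;> simp

/-- The second-order term has two sources: the quadratic term of (1 + r x^a)^(e+1), which carries
the binomial coefficient, and the change of variable `g * f` applied to the leading term. -/
theorem commutator_mono {a e m : ℕ} (ha : 1 ≤ a) (he : a < e) (r s : R)
    (hm1 : m ≤ a + 2 * e + 1) (hm2 : m ≤ 3 * a + e + 1) :
    (X : R⟦X⟧) ^ m ∣ ⁅mono a r, mono e s⁆.toSeries - X -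
      (X ^ (a + e + 1) * C (((a : R) - e) * r * s) +
        X ^ (2 * a + e + 1) * C (-(s * r ^ 2 * ((e + 1).choose 2 : ℕ)) -
          ((a : R) - e) * r * s * (a + e + 1) * r)) := by
  set L : R := ((a : R) - e) * r * s with hL
  set t : R := -(s * r ^ 2 * ((e + 1).choose 2 : ℕ)) - L * (a + e + 1) * r with ht
  set f : JenningsGroup R := mono a r with hf
  set g : JenningsGroup R := mono e s with hg
  have hfm : f ∈ filt R a := mono_mem_filt r
  have hgm : g ∈ filt R e := mono_mem_filt s
  have hfs := toSeries_mono ha r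
  have hgs := toSeries_mono (ha.trans he.le) s
  have hfX : f.toSeries - X = X ^ (a + 1) * C r := by rw [hf, hfs]; ring
  have hgX : g.toSeries - X = X ^ (e + 1) * C s := by rw [hg, hgs]; ring
  set T : R⟦X⟧ := X ^ (a + e + 1) * C L + X ^ (2 * a + e + 1) * C t with hT
  apply commutator_congr
  have h1 : (X : R⟦X⟧) ^ m ∣ (f.toSeries - X).subst g.toSeries - (f.toSeries - X) -
      X ^ (a + e + 1) * C ((a + 1) * r * s) := by
    have h := (pow_dvd_pow _ (show m ≤ a + 1 + 2 * e by omega)).trans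
      (taylor hgm (mem_filt.1 hfm))
    convert h using 2
    rw [hgX, hfX, Derivation.leibniz, derivative_pow, derivative_X, derivative_C]
    simp only [smul_eq_mul, map_mul, map_add, map_natCast, map_one, Nat.cast_add,
      Nat.cast_one, Nat.add_sub_cancel]
    ring
  have h2 : (X : R⟦X⟧) ^ m ∣ (g.toSeries - X).subst f.toSeries - (g.toSeries - X) -
      (X ^ (a + e + 1) * C ((e + 1) * r * s) +
        X ^ (2 * a + e + 1) * C (s * r ^ 2 * ((e + 1).choose 2 : ℕ))) := by
    obtain ⟨k, hk⟩ := exists_one_add_pow_eq (X ^ a * C r) (e + 1)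
    rw [hgX, mul_comm, subst_C_mul, subst_pow f.hasSubst, subst_X f.hasSubst, hf, hfs,
      show (X + X ^ (a + 1) * C r : R⟦X⟧) = X * (1 + X ^ a * C r) by ring, mul_pow, hk]
    refine (pow_dvd_pow _ hm2).trans ⟨C s * k * C r ^ 3, ?_⟩
    simp only [map_mul, map_add, map_natCast, map_one, map_pow, Nat.cast_add, Nat.cast_one]
    ring
  have hgf : (X : R⟦X⟧) ^ (e + 1) ∣ (g * f).toSeries - X - X ^ (a + 1) * C r := by
    rw [toSeries_mul_sub_X, hfX, add_sub_cancel_right]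
    exact X_pow_dvd_subst f (mem_filt.1 hgm)
  have hTX : (X : R⟦X⟧) ^ (a + e + 1) ∣ T :=
    ⟨C L + X ^ a * C t, by rw [hT]; ring⟩
  have h3 := (pow_dvd_pow _ (show m ≤ a + e + 1 + 2 * a by omega)).trans
    (taylor (mul_mem (filt_anti he.le hgm) hfm) hTX)
  have h4 : (X : R⟦X⟧) ^ m ∣ d⁄dX R T * ((g * f).toSeries - X) -
      X ^ (2 * a + e + 1) * C (L * (a + e + 1) * r) := by
    have hT' : d⁄dX R T = X ^ (a + e) * (C (L * (a + e + 1)) +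
        X ^ a * C (t * (2 * a + e + 1))) := by
      rw [hT, map_add, Derivation.leibniz, Derivation.leibniz, derivative_pow, derivative_pow,
        derivative_X, derivative_C, derivative_C]
      simp only [smul_eq_mul, map_mul, map_add, map_natCast, map_one, Nat.cast_add,
        Nat.cast_one, Nat.add_sub_cancel, Nat.cast_mul, Nat.cast_ofNat, map_ofNat]
      ring
    obtain ⟨k, hk⟩ := hgf
    have h5 : (g * f).toSeries - X = X ^ (a + 1) * C r + X ^ (e + 1) * k := by
      linear_combination hk
    rw [h5, hT', show X ^ (a + e) * (C (L * (a + e + 1)) + X ^ a * C (t * (2 * a + e + 1))) *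
        (X ^ (a + 1) * C r + X ^ (e + 1) * k) - X ^ (2 * a + e + 1) * C (L * (a + e + 1) * r) =
        X ^ (3 * a + e + 1) * (C (t * (2 * a + e + 1)) * C r) +
        X ^ (a + 2 * e + 1) * ((C (L * (a + e + 1)) + X ^ a * C (t * (2 * a + e + 1))) * k) by
      simp only [map_mul]; ring]
    exact dvd_add (Dvd.dvd.mul_right (pow_dvd_pow _ hm2) _)
      (Dvd.dvd.mul_right (pow_dvd_pow _ hm1) _)
  have h := dvd_add (dvd_add h3 h4) (dvd_sub h2 h1)
  refine Eq.mp (congrArg _ ?_) h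
  have hLC : (C L : R⟦X⟧) = C ((a + 1) * r * s) - C ((e + 1) * r * s) := by
    rw [← map_sub, hL]; congr 1; ring
  have htC : (C t : R⟦X⟧) = - C (s * r ^ 2 * ((e + 1).choose 2 : ℕ)) -
      C (L * (a + e + 1) * r) := by
    rw [← map_neg, ← map_sub]
  have hTe : T = X ^ (a + e + 1) * (C ((a + 1) * r * s) - C ((e + 1) * r * s)) +
    X ^ (2 * a + e + 1) * (- C (s * r ^ 2 * ((e + 1).choose 2 : ℕ)) -
      C (L * (a + e + 1) * r)) := by rw [hT, hLC, htC]
  linear_combination -hTe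

theorem commutator_mono_leading {a e : ℕ} (ha : 1 ≤ a) (he : 1 ≤ e) (r s : R) :
    (X : R⟦X⟧) ^ (a + e + min a e + 1) ∣ ⁅mono a r, mono e s⁆.toSeries - X -
      X ^ (a + e + 1) * C (((a : R) - e) * r * s) := by
  set L : R := ((a : R) - e) * r * s with hL
  set f : JenningsGroup R := mono a r with hf
  set g : JenningsGroup R := mono e s with hg
  have hfm : f ∈ filt R a := mono_mem_filt r
  have hgm : g ∈ filt R e := mono_mem_filt s
  have hfX : f.toSeries - X = X ^ (a + 1) * C r := by rw [hf, toSeries_mono ha]; ring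
  have hgX : g.toSeries - X = X ^ (e + 1) * C s := by rw [hg, toSeries_mono he]; ring
  apply commutator_congr
  have h1 := (pow_dvd_pow _ (show a + e + min a e + 1 ≤ a + 1 + 2 * e by omega)).trans
    (taylor hgm (mem_filt.1 hfm))
  have h2 := (pow_dvd_pow _ (show a + e + min a e + 1 ≤ e + 1 + 2 * a by omega)).trans
    (taylor hfm (mem_filt.1 hgm))
  have h3 := (pow_dvd_pow _ (show a + e + min a e + 1 ≤ a + e + 1 + min a e by omega)).trans
    (X_pow_dvd_subst_sub_self (mul_mem (filt_anti (min_le_right a e) hgm)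
      (filt_anti (min_le_left a e) hfm)) (Dvd.intro (C L) rfl))
  refine Eq.mp (congrArg _ ?_) (dvd_add (dvd_sub h3 h1) h2)
  have e1 : d⁄dX R (f.toSeries - X) * (g.toSeries - X) = X ^ (a + e + 1) * C ((a + 1) * r * s) := by
    rw [hgX, hfX, Derivation.leibniz, derivative_pow, derivative_X, derivative_C]
    simp only [smul_eq_mul, map_mul, map_add, map_natCast, map_one, Nat.cast_add,
      Nat.cast_one, Nat.add_sub_cancel]
    ring
  have e2 : d⁄dX R (g.toSeries - X) * (f.toSeries - X) = X ^ (a + e + 1) * C ((e + 1) * r * s) := by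
    rw [hgX, hfX, Derivation.leibniz, derivative_pow, derivative_X, derivative_C]
    simp only [smul_eq_mul, map_mul, map_add, map_natCast, map_one, Nat.cast_add,
      Nat.cast_one, Nat.add_sub_cancel]
    ring
  have hLC : (C L : R⟦X⟧) = C ((a + 1) * r * s) - C ((e + 1) * r * s) := by
    rw [← map_sub, hL]; congr 1; ring
  linear_combination e1 - e2 - X ^ (a + e + 1) * hLC

/-! ### Leading terms realized by commutators -/

/-- The subgroup generated by the commutators `⁅x + x ^ (d + i + 1), h⁆` with `i < 4` and `h` of
depth at least `d` and at least `E`. -/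
noncomputable def monoCommutators (d E : ℕ) : Subgroup (JenningsGroup ℤ) :=
  Subgroup.closure {z | ∃ i < 4, ∃ h ∈ filt ℤ d, h ∈ filt ℤ E ∧ z = ⁅mono (d + i) (1 : ℤ), h⁆}

theorem commutator_mono_mem_monoCommutators {d E a e : ℕ} (ha : d ≤ a) (ha' : a < d + 4)
    (he : d ≤ e) (hE : E ≤ e) (s : ℤ) : ⁅mono a (1 : ℤ), mono e s⁆ ∈ monoCommutators d E := by
  refine Subgroup.subset_closure ⟨a - d, by omega, mono e s, filt_anti he (mono_mem_filt s),
    filt_anti hE (mono_mem_filt s), ?_⟩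
  rw [Nat.add_sub_cancel' ha]

theorem monoCommutators_le {d E : ℕ} : monoCommutators d E ≤ ⁅filt ℤ d, filt ℤ d⁆ := by
  rw [monoCommutators, Subgroup.closure_le]
  rintro _ ⟨i, -, h, hd, -, rfl⟩
  exact Subgroup.commutator_mem_commutator (filt_anti (by omega) (mono_mem_filt 1)) hd

theorem X_pow_dvd_mul_of_dvd {R : Type*} [CommRing R] {n M : ℕ} {f g : JenningsGroup R}
    {S T : R⟦X⟧} (hf : f ∈ filt R n) (hg : g ∈ filt R n) (hM : M ≤ 2 * n + 1)
    (hS : (X : R⟦X⟧) ^ M ∣ f.toSeries - X - S) (hT : (X : R⟦X⟧) ^ M ∣ g.toSeries - X - T) :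
    (X : R⟦X⟧) ^ M ∣ (f * g).toSeries - X - (S + T) := by
  have h := (pow_dvd_pow _ hM).trans (X_pow_dvd_mul_toSeries hf hg)
  refine Eq.mp (congrArg _ ?_) (dvd_add (dvd_add h hS) hT)
  ring

theorem mem_filt_of_dvd {R : Type*} [CommRing R] {n M : ℕ} {f : JenningsGroup R} {S : R⟦X⟧}
    (h : (X : R⟦X⟧) ^ M ∣ f.toSeries - X - S) (hM : n + 1 ≤ M) (hS : (X : R⟦X⟧) ^ (n + 1) ∣ S) :
    f ∈ filt R n := by
  rw [mem_filt]
  simpa using dvd_add ((pow_dvd_pow _ hM).trans h) hS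

theorem coeff_eq_of_dvd {R : Type*} [CommRing R] {n M : ℕ} {f : JenningsGroup R} {S : R⟦X⟧}
    (h : (X : R⟦X⟧) ^ M ∣ f.toSeries - X - S) (hM : n < M) (hn : 2 ≤ n) :
    coeff n f.toSeries = coeff n S := by
  have h1 := X_pow_dvd_iff.1 h n hM
  have hX : coeff n (X : R⟦X⟧) = 0 := by rw [coeff_X, if_neg (by omega)]
  rw [map_sub, map_sub, hX] at h1
  linear_combination h1

theorem coeff_X_pow_mul_C {R : Type*} [CommRing R] (n m : ℕ) (c : R) :
    coeff n (X ^ m * C c : R⟦X⟧) = if n = m then c else 0 := by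
  rw [mul_comm, coeff_C_mul, coeff_X_pow]
  split_ifs <;> simp

/-- Products of two commutators realize `x + c x ^ (m + 1)` to leading order. -/
theorem exists_linear {d m E : ℕ} (hd : 1 ≤ d) (hm : 2 * d + 1 ≤ m) (hE : E + d + 1 ≤ m) (c : ℤ)
    (hc : Even m → Even c) :
    ∃ w ∈ monoCommutators d E, (X : ℤ⟦X⟧) ^ (m + d + 1) ∣ w.toSeries - X - X ^ (m + 1) * C c := by
  -- Bézout: the two leading factors differ by 2, so they generate ℤ for odd `m` and 2ℤ for even
  -- `m`.
  obtain ⟨r, s, hrs⟩ : ∃ r s : ℤ, (2 * d - m) * r + (2 * d + 2 - m) * s = c := by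
    rcases Nat.even_or_odd' m with ⟨t, rfl | rfl⟩
    · obtain ⟨c', rfl⟩ := hc (even_two_mul t)
      exact ⟨-c', c', by ring⟩
    · exact ⟨(1 + ((d : ℤ) - t - 1)) * c, -((d : ℤ) - t - 1) * c, by push_cast; ring⟩
  obtain ⟨j, rfl⟩ : ∃ j, m = 2 * d + 1 + j := ⟨m - (2 * d + 1), by omega⟩
  refine ⟨⁅mono d (1 : ℤ), mono (d + 1 + j) r⁆ * ⁅mono (d + 1) (1 : ℤ), mono (d + j) s⁆,
    mul_mem (commutator_mono_mem_monoCommutators (by omega) (by omega) (by omega) (by omega) _)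
      (commutator_mono_mem_monoCommutators (by omega) (by omega) (by omega) (by omega) _), ?_⟩
  have h1 := (pow_dvd_pow _ (show 2 * d + 1 + j + d + 1 ≤ _ by omega)).trans
    (commutator_mono_leading hd (show 1 ≤ d + 1 + j by omega) (1 : ℤ) r)
  have h2 := (pow_dvd_pow _ (show 2 * d + 1 + j + d + 1 ≤ _ by omega)).trans
    (commutator_mono_leading (show 1 ≤ d + 1 by omega) (show 1 ≤ d + j by omega) (1 : ℤ) s)
  rw [show d + (d + 1 + j) + 1 = 2 * d + 1 + j + 1 by ring] at h1
  rw [show d + 1 + (d + j) + 1 = 2 * d + 1 + j + 1 by ring] at h2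
  have h := X_pow_dvd_mul_of_dvd (n := 2 * d + 1 + j)
    (mem_filt_of_dvd h1 (by omega) (Dvd.intro _ rfl))
    (mem_filt_of_dvd h2 (by omega) (Dvd.intro _ rfl)) (by omega) h1 h2
  rwa [← mul_add, ← map_add, show ((d : ℤ) - (d + 1 + j : ℕ)) * 1 * r +
    ((d + 1 : ℕ) - (d + j : ℕ)) * 1 * s = c by push_cast; push_cast at hrs; linarith] at h

theorem odd_choose_two {e : ℕ} (he : e % 4 = 2) : Odd ((e + 1).choose 2) := by
  obtain ⟨t, rfl⟩ : ∃ t, e = 4 * t + 2 := ⟨e / 4, by omega⟩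
  rw [Nat.choose_two_right, Nat.odd_iff,
    show (4 * t + 2 + 1) * (4 * t + 2 + 1 - 1) = 2 * ((4 * t + 3) * (2 * t + 1)) by
      rw [Nat.add_sub_cancel]; ring, Nat.mul_div_cancel_left _ (by norm_num),
    show (4 * t + 3) * (2 * t + 1) = 2 * (4 * t ^ 2 + 5 * t + 1) + 1 by ring]
  omega

/-- A product of two commutators whose leading terms cancel, and whose next coefficient is odd. -/
theorem exists_odd {d E a e : ℕ} (hd : 1 ≤ d) (ha : d ≤ a) (ha' : a ≤ d + 1) (he : e % 4 = 2)
    (hae : a + 3 ≤ e) (hE : E + 2 ≤ e) :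
    ∃ w ∈ monoCommutators d E, w ∈ filt ℤ (2 * a + e) ∧
      Odd (coeff (2 * a + e + 1) w.toSeries) := by
  -- The second commutator has entries of depths `b` and `a + e - b`. Cancelling the leading terms
  -- with `β` odd requires that `2 * b - (e + a)` be no more divisible by two than `a - e`; `b = a +
  -- 1` works unless `e - a ≡ 2 mod 4`, when `b = a + 2` does.
  obtain ⟨b, α, β, hb, hb', hab, hβ⟩ : ∃ (b : ℕ) (α β : ℤ), a < b ∧ b ≤ a + 2 ∧
      2 * b < e + a ∧ ((a : ℤ) - e) * β = (2 * b - (e + a)) * α ∧ Odd β ∧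
      Even (((a : ℤ) - e) * β * (a + e + 1)) := by
    obtain ⟨δ, rfl⟩ : ∃ δ, e = a + δ := ⟨e - a, by omega⟩
    rcases Nat.even_or_odd' δ with ⟨q, rfl | rfl⟩
    · rcases Nat.even_or_odd' q with ⟨t, rfl | rfl⟩
      · refine ⟨a + 1, 2 * t, 2 * t - 1, by omega, by omega, by omega, by push_cast; ring,
          ⟨t - 1, by ring⟩, ?_⟩
        exact ⟨-2 * t * (2 * t - 1) * (2 * a + 4 * t + 1), by push_cast; ring⟩
      · refine ⟨a + 2, 2 * t + 1, 2 * t - 1, by omega, by omega, by omega, by push_cast; ring,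
          ⟨t - 1, by ring⟩, ?_⟩
        exact ⟨-(2 * t + 1) * (2 * t - 1) * (2 * a + 4 * t + 3), by push_cast; ring⟩
    · refine ⟨a + 1, 2 * q + 1, 2 * q - 1, by omega, by omega, by omega, by push_cast; ring,
        ⟨q - 1, by ring⟩, ?_⟩
      exact ⟨-(2 * q + 1) * (2 * q - 1) * (a + q + 1), by push_cast; ring⟩
  obtain ⟨e', he'⟩ : ∃ e', e + a = b + e' := ⟨e + a - b, by omega⟩
  have h1 := commutator_mono (m := 2 * a + e + 2) (by omega) (show a < e by omega) (1 : ℤ) β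
    (by omega) (by omega)
  -- Since both depths `b` and `e'` exceed `a`, the second commutator contributes nothing beyond its
  -- leading term at this precision.
  have h2 := (pow_dvd_pow _ (show 2 * a + e + 2 ≤ _ by omega)).trans
    (commutator_mono_leading (show 1 ≤ b by omega) (show 1 ≤ e' by omega) (1 : ℤ) (-α))
  rw [show b + e' + 1 = a + e + 1 by omega] at h2
  have h := X_pow_dvd_mul_of_dvd (n := a + e)
    (mem_filt_of_dvd h1 (by omega) (dvd_add (Dvd.dvd.mul_right (pow_dvd_pow _ (by omega)) _)
      (Dvd.dvd.mul_right (pow_dvd_pow _ (by omega)) _)))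
    (mem_filt_of_dvd h2 (by omega) (Dvd.intro _ rfl)) (by omega) h1 h2
  have hC : (C (((a : ℤ) - e) * 1 * β) + C (((b : ℤ) - e') * 1 * -α) : ℤ⟦X⟧) = 0 := by
    rw [← map_add, show ((a : ℤ) - e) * 1 * β + ((b : ℤ) - e') * 1 * -α = 0 by
      have : (e' : ℤ) = e + a - b := by omega
      rw [this]; linear_combination hβ.1, map_zero]
  rw [add_right_comm (X ^ (a + e + 1) * _ : ℤ⟦X⟧), ← mul_add, hC, mul_zero, zero_add] at h
  refine ⟨_, mul_mem (commutator_mono_mem_monoCommutators (by omega) (by omega) (by omega)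
    (by omega) _) (commutator_mono_mem_monoCommutators (by omega) (by omega) (by omega)
    (by omega) _), mem_filt_of_dvd h (by omega) (Dvd.intro _ rfl), ?_⟩
  rw [coeff_eq_of_dvd h (by omega) (by omega), coeff_X_pow_mul_C, if_pos rfl]
  obtain ⟨-, hodd, heven⟩ := hβ
  have h3 : Odd (β * ((e + 1).choose 2 : ℕ)) :=
    hodd.mul (by exact_mod_cast odd_choose_two he)
  refine Eq.mp (congrArg Odd ?_) (h3.add_even heven).neg
  ring

/-- The case `a = d + 1`, `e = d + 2` that `exists_odd` misses because `e` is too close to `a`. The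
factors 3 and -1 cancel the leading terms, but the second commutator leaves a term at depth `3 * d +
3`. That depth is odd, so `exists_linear` removes the term. -/
theorem exists_odd_of_four_dvd {d : ℕ} (hd : 4 ≤ d) (hd4 : d % 4 = 0) :
    ∃ w ∈ monoCommutators d d, w ∈ filt ℤ (3 * d + 4) ∧ Odd (coeff (3 * d + 5) w.toSeries) := by
  have h1 := commutator_mono (m := 3 * d + 6) (show 1 ≤ d + 1 by omega)
    (show d + 1 < d + 2 by omega) (1 : ℤ) 3 (by omega) (by omega)
  have h2 := commutator_mono (m := 3 * d + 6) (show 1 ≤ d by omega)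
    (show d < d + 3 by omega) (1 : ℤ) (-1) (by omega) (by omega)
  rw [show d + 1 + (d + 2) + 1 = 2 * d + 4 by omega,
    show 2 * (d + 1) + (d + 2) + 1 = 3 * d + 5 by omega] at h1
  rw [show d + (d + 3) + 1 = 2 * d + 4 by omega,
    show 2 * d + (d + 3) + 1 = 3 * d + 4 by omega] at h2
  set t1 : ℤ := -(3 * 1 ^ 2 * ((d + 2 + 1).choose 2 : ℕ)) -
          (((d + 1 : ℕ) : ℤ) - (d + 2 : ℕ)) * 1 * 3 * ((d + 1 : ℕ) + (d + 2 : ℕ) + 1) * 1 with ht1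
  set t2 : ℤ := -(-1 * 1 ^ 2 * ((d + 3 + 1).choose 2 : ℕ)) -
          ((d : ℤ) - (d + 3 : ℕ)) * 1 * -1 * (d + (d + 3 : ℕ) + 1) * 1
  have h := X_pow_dvd_mul_of_dvd (n := 2 * d + 3)
    (mem_filt_of_dvd h1 (by omega) (dvd_add (Dvd.dvd.mul_right (pow_dvd_pow _ (by omega)) _)
      (Dvd.dvd.mul_right (pow_dvd_pow _ (by omega)) _)))
    (mem_filt_of_dvd h2 (by omega) (dvd_add (Dvd.dvd.mul_right (pow_dvd_pow _ (by omega)) _)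
      (Dvd.dvd.mul_right (pow_dvd_pow _ (by omega)) _))) (by omega) h1 h2
  have hC : (C ((((d + 1 : ℕ) : ℤ) - (d + 2 : ℕ)) * 1 * 3) +
      C (((d : ℤ) - (d + 3 : ℕ)) * 1 * -1) : ℤ⟦X⟧) = 0 := by
    rw [← map_add, ← map_zero C]; congr 1; push_cast; ring
  obtain ⟨w, hw, hwd⟩ := exists_linear (d := d) (m := 3 * d + 3) (E := d) (by omega) (by omega)
    (by omega) (-t2) (fun he => by
      exfalso
      rw [Nat.even_iff] at he
      omega)
  have hwd := (pow_dvd_pow _ (show 3 * d + 6 ≤ _ by omega)).trans hwd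
  rw [show 3 * d + 3 + 1 = 3 * d + 4 by rfl] at hwd
  have h' := X_pow_dvd_mul_of_dvd (n := 3 * d + 3)
    (mem_filt_of_dvd h (by omega) ⟨C t2 + X * C t1, by
      linear_combination X ^ (2 * d + 4) * hC⟩)
    (mem_filt_of_dvd hwd (by omega) (Dvd.intro _ rfl)) (by omega) h hwd
  rw [show X ^ (2 * d + 4) * C ((((d + 1 : ℕ) : ℤ) - (d + 2 : ℕ)) * 1 * 3) +
    X ^ (3 * d + 5) * C t1 + (X ^ (2 * d + 4) * C (((d : ℤ) - (d + 3 : ℕ)) * 1 * -1) +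
    X ^ (3 * d + 4) * C t2) + X ^ (3 * d + 4) * C (-t2) = (X ^ (3 * d + 5) * C t1 : ℤ⟦X⟧) by
      rw [map_neg]; linear_combination X ^ (2 * d + 4) * hC] at h'
  refine ⟨_, mul_mem (mul_mem (commutator_mono_mem_monoCommutators (by omega) (by omega)
    (by omega) (by omega) _) (commutator_mono_mem_monoCommutators (by omega) (by omega)
    (by omega) (by omega) _)) hw, mem_filt_of_dvd h' (by omega) (Dvd.intro _ rfl), ?_⟩
  rw [coeff_eq_of_dvd h' (by omega) (by omega), coeff_X_pow_mul_C, if_pos rfl]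
  have h3 : Odd (((d + 2 + 1).choose 2 : ℕ) : ℤ) := by
    exact_mod_cast odd_choose_two (show (d + 2) % 4 = 2 by omega)
  obtain ⟨y, hy⟩ := h3
  exact ⟨-3 * y + 3 * d + 4, by rw [ht1, hy]; push_cast; ring⟩

/-- The depths at which `G' = ⁅J_{d+1}, J_{d+1}⁆` is shown to contain a series with leading
coefficient one. -/
def Good (d m : ℕ) : Prop :=
  m % 2 = 1 ∨ ((m - 2 * d) % 4 = 2 ∧ 3 * d + 3 ≤ m) ∨
    ((m - 2 * d - 2) % 4 = 2 ∧ 3 * d + 6 ≤ m) ∨ (d % 4 = 0 ∧ m = 3 * d + 4)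

theorem exists_leading_coeff_two {d m : ℕ} (hd : 4 ≤ d) (hm : 2 * d + 1 ≤ m) :
    ∃ w ∈ monoCommutators d (m - 2 * d - 4), w ∈ filt ℤ m ∧ coeff (m + 1) w.toSeries = 2 := by
  obtain ⟨w, hw, hwd⟩ := exists_linear (d := d) (m := m) (E := m - 2 * d - 4) (by omega) hm
    (by omega) 2 (fun _ => even_two)
  refine ⟨w, hw, mem_filt_of_dvd hwd (by omega) (Dvd.intro _ rfl), ?_⟩
  rw [coeff_eq_of_dvd hwd (by omega) (by omega), coeff_X_pow_mul_C, if_pos rfl]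

theorem exists_leading_coeff_one {d m : ℕ} (hd : 4 ≤ d) (hm : 2 * d + 1 ≤ m) (h : Good d m) :
    ∃ w ∈ monoCommutators d (m - 2 * d - 4), w ∈ filt ℤ m ∧ coeff (m + 1) w.toSeries = 1 := by
  obtain ⟨w, hw, hwm, hodd⟩ : ∃ w ∈ monoCommutators d (m - 2 * d - 4), w ∈ filt ℤ m ∧
      Odd (coeff (m + 1) w.toSeries) := by
    rcases h with h | ⟨h, h'⟩ | ⟨h, h'⟩ | ⟨h, rfl⟩
    · obtain ⟨w, hw, hwd⟩ := exists_linear (d := d) (m := m) (E := m - 2 * d - 4) (by omega) hm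
        (by omega) 1 (fun he => by
          exfalso
          rw [Nat.even_iff] at he
          omega)
      refine ⟨w, hw, mem_filt_of_dvd hwd (by omega) (Dvd.intro _ rfl), ?_⟩
      rw [coeff_eq_of_dvd hwd (by omega) (by omega), coeff_X_pow_mul_C, if_pos rfl]
      exact odd_one
    · have := exists_odd (d := d) (E := m - 2 * d - 4) (a := d) (e := m - 2 * d) (by omega)
        le_rfl (by omega) h (by omega) (by omega)
      rwa [show 2 * d + (m - 2 * d) = m by omega] at this
    · have := exists_odd (d := d) (E := m - 2 * d - 4) (a := d + 1) (e := m - 2 * d - 2) (by omega)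
        (by omega) le_rfl h (by omega) (by omega)
      rwa [show 2 * (d + 1) + (m - 2 * d - 2) = m by omega] at this
    · have := exists_odd_of_four_dvd hd h
      rwa [show 3 * d + 4 - 2 * d - 4 = d by omega]
  -- An even correction is available at every depth, so an odd leading coefficient can be adjusted
  -- to one.
  obtain ⟨v, hv, hvd⟩ := exists_linear (d := d) (m := m) (E := m - 2 * d - 4) (by omega) hm
    (by omega) (1 - coeff (m + 1) w.toSeries) (fun _ => odd_one.sub_odd hodd)
  have hvm : v ∈ filt ℤ m := mem_filt_of_dvd hvd (by omega) (Dvd.intro _ rfl)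
  refine ⟨w * v, mul_mem hw hv, mul_mem hwm hvm, ?_⟩
  rw [coeff_mul_of_mem_filt hwm hvm (by omega) (by omega),
    coeff_eq_of_dvd hvd (by omega) (by omega), coeff_X_pow_mul_C, if_pos rfl]
  ring

/-- For even `m` one of `m - 2 * d` and `m - 2 * d - 2` is 2 modulo 4. -/
theorem good_of_le {d m : ℕ} (h : 3 * d + 6 ≤ m) : Good d m := by
  unfold Good
  omega

/-! ### Additive coefficients and completeness -/

/-- On series of depth at least `m`, the coefficients of index at most `2 * m` are additive. -/
noncomputable def coeffHom (R : Type*) [CommRing R] (m j : ℕ) (h2 : 2 ≤ j) (hj : j ≤ 2 * m) :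
    filt R m →* Multiplicative R :=
  MonoidHom.mk' (fun f => Multiplicative.ofAdd (coeff j f.1.toSeries))
    (fun f g => congrArg Multiplicative.ofAdd (coeff_mul_of_mem_filt f.2 g.2 hj h2))

theorem coeff_zpow {m j : ℕ} {f : JenningsGroup R} (hf : f ∈ filt R m) (h2 : 2 ≤ j)
    (hj : j ≤ 2 * m) (n : ℤ) : coeff j (f ^ n).toSeries = n * coeff j f.toSeries := by
  have h := map_zpow (coeffHom R m j h2 hj) ⟨f, hf⟩ n
  have h' : coeff j (f ^ n).toSeries = n • coeff j f.toSeries := congrArg Multiplicative.toAdd h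
  rw [h', zsmul_eq_mul]

theorem coeff_eq_zero_of_mem_filt {m j : ℕ} {f : JenningsGroup R} (hf : f ∈ filt R m)
    (h2 : 2 ≤ j) (hj : j ≤ m) : coeff j f.toSeries = 0 := hf j h2 (by omega)

theorem mem_filt_succ_iff {m : ℕ} (hm : 1 ≤ m) {f : JenningsGroup R} (hf : f ∈ filt R m) :
    f ∈ filt R (m + 1) ↔ coeff (m + 1) f.toSeries = 0 := by
  refine ⟨fun h => coeff_eq_zero_of_mem_filt h (by omega) le_rfl, fun h i h2 hi => ?_⟩
  rcases Nat.lt_or_ge i (m + 1) with h' | h'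
  · exact hf i h2 h'
  · rwa [show i = m + 1 by omega]

theorem mul_inv_mem_filt_succ {m : ℕ} (hm : 1 ≤ m) {f g : JenningsGroup R} (hf : f ∈ filt R m)
    (hg : g ∈ filt R m) (h : coeff (m + 1) f.toSeries = coeff (m + 1) g.toSeries) :
    f * g⁻¹ ∈ filt R (m + 1) := by
  rw [mem_filt_succ_iff hm (mul_mem hf (inv_mem hg)),
    coeff_mul_of_mem_filt hf (inv_mem hg) (by omega) (by omega), h, ← zpow_neg_one,
    coeff_zpow hg (by omega) (by omega)]
  simp

theorem eq_one_of_forall_mem_filt {f : JenningsGroup R} (h : ∀ n, f ∈ filt R n) : f = 1 := by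
  ext n
  have := X_pow_dvd_iff.1 (mem_filt.1 (h n)) n (by omega)
  rw [map_sub] at this
  rw [toSeries_one]
  linear_combination this

theorem quot_eq_iff {n : ℕ} {f g : JenningsGroup R} :
    (f : JenningsGroup R ⧸ filt R n) = g ↔ (X : R⟦X⟧) ^ (n + 1) ∣ f.toSeries - g.toSeries := by
  rw [← mul_inv_mem_filt_iff, ← QuotientGroup.eq_one_iff, QuotientGroup.mk_mul,
    QuotientGroup.mk_inv, mul_inv_eq_one]

/-- The Jennings group is complete. -/
theorem exists_limit {e : ℕ} (s : ℕ → JenningsGroup R) (hs : ∀ n,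
    (s n : JenningsGroup R ⧸ filt R (e + n)) = s (n + 1)) :
    ∃ l : JenningsGroup R, ∀ n, (s n : JenningsGroup R ⧸ filt R (e + n)) = l := by
  have hc : ∀ n k j, j ≤ e + n → coeff j (s n).toSeries = coeff j (s (n + k)).toSeries := by
    intro n k j hj
    induction k with
    | zero => rfl
    | succ k ih =>
      have h := X_pow_dvd_iff.1 (quot_eq_iff.1 (hs (n + k))) j (by omega)
      rw [map_sub] at h
      rw [ih, ← add_assoc]
      linear_combination h
  -- A diagonal limit: coefficient `j` is stable from the `j`-th term on.
  refine ⟨⟨PowerSeries.mk fun j => coeff j (s j).toSeries, ?_, ?_⟩, fun n => ?_⟩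
  · rw [coeff_mk]; exact (s 0).coeff_zero
  · rw [coeff_mk]; exact (s 1).coeff_one
  · rw [quot_eq_iff, X_pow_dvd_iff]
    intro j hj
    rw [map_sub, coeff_mk, sub_eq_zero]
    rcases Nat.le_total n j with h | h
    · obtain ⟨k, rfl⟩ := Nat.exists_eq_add_of_le h
      exact hc n k _ (by omega)
    · obtain ⟨k, rfl⟩ := Nat.exists_eq_add_of_le h
      exact (hc j k _ (by omega)).symm

/-! ### Large depth lies in the commutator subgroup -/

theorem prod_map_mul_of_commute {ι G : Type*} [Group G] (l : List ι) (x y : ι → G)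
    (h : ∀ i j, Commute (y i) (x j)) :
    (l.map fun i => x i * y i).prod = (l.map x).prod * (l.map y).prod := by
  induction l with
  | nil => simp
  | cons a l ih =>
    have hc : Commute (y a) (l.map x).prod := Commute.list_prod_right _ _ (by
      simp only [List.mem_map]
      rintro _ ⟨j, -, rfl⟩
      exact h a j)
    simp only [List.map_cons, List.prod_cons, ih]
    rw [mul_assoc (x a), ← mul_assoc (y a), hc.eq]
    simp only [mul_assoc]

theorem commutatorElement_mul_of_commute {G : Type*} [Group G] {f g h : G}
    (hc : Commute ⁅f, h⁆ g) : ⁅f, g * h⁆ = ⁅f, g⁆ * ⁅f, h⁆ := by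
  rw [commutatorElement_mul_right_eq_mul_conj, mul_assoc ⁅f, g⁆, ← hc.eq]
  group

/-- The product of the commutators `⁅x + x ^ (d + i + 1), g i⁆` for `i < 4`. -/
noncomputable def commProd (d : ℕ) (g : Fin 4 → JenningsGroup ℤ) : JenningsGroup ℤ :=
  ((List.finRange 4).map fun i : Fin 4 => ⁅mono (d + i) (1 : ℤ), g i⁆).prod

theorem commute_mk {a b n : ℕ} (h : n ≤ a + b) {f g : JenningsGroup ℤ} (hf : f ∈ filt ℤ a)
    (hg : g ∈ filt ℤ b) : Commute (f : JenningsGroup ℤ ⧸ filt ℤ n) g := by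
  rw [← commutatorElement_eq_one_iff_commute, ← QuotientGroup.mk'_apply, ← QuotientGroup.mk'_apply,
    ← map_commutatorElement, QuotientGroup.mk'_apply, QuotientGroup.eq_one_iff]
  exact filt_anti h (commutator_mem_filt_add hf hg)

theorem mk_commProd (d n : ℕ) (g : Fin 4 → JenningsGroup ℤ) :
    (commProd d g : JenningsGroup ℤ ⧸ filt ℤ n) =
      ((List.finRange 4).map fun i : Fin 4 => ⁅((mono (d + i) (1 : ℤ) : JenningsGroup ℤ) :
        JenningsGroup ℤ ⧸ filt ℤ n), (g i : JenningsGroup ℤ ⧸ filt ℤ n)⁆).prod := by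
  rw [commProd, ← QuotientGroup.mk'_apply, map_list_prod, List.map_map]
  congr 1

/-- The identity ⁅f, gh⁆ = ⁅f, g⁆ · g⁅f, h⁆g⁻¹ becomes multiplicative once ⁅f, h⁆, of depth `d + E`,
commutes with `g`, of depth `D`, modulo depth `n`. -/
theorem mk_commProd_mul {d E D n : ℕ} (hn : n ≤ D + E + d) {g h : Fin 4 → JenningsGroup ℤ}
    (hg : ∀ i, g i ∈ filt ℤ D) (hh : ∀ i, h i ∈ filt ℤ E) :
    (commProd d (g * h) : JenningsGroup ℤ ⧸ filt ℤ n) = commProd d g * commProd d h := by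
  have hf : ∀ i : Fin 4, mono (d + i) (1 : ℤ) ∈ filt ℤ d :=
    fun i => filt_anti (by omega) (mono_mem_filt _)
  have hy : ∀ i : Fin 4, ⁅mono (d + i) (1 : ℤ), h i⁆ ∈ filt ℤ (d + E) :=
    fun i => commutator_mem_filt_add (hf i) (hh i)
  have hx : ∀ i : Fin 4, ⁅mono (d + i) (1 : ℤ), g i⁆ ∈ filt ℤ D :=
    fun i => filt_anti (by omega) (commutator_mem_filt_add (hf i) (hg i))
  simp only [mk_commProd]
  rw [← prod_map_mul_of_commute]
  · congr 2
    funext i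
    rw [Pi.mul_apply, QuotientGroup.mk_mul]
    exact commutatorElement_mul_of_commute
      (commute_mk (show n ≤ d + E + D by omega) (hy i) (hg i))
  · intro i j
    exact commute_mk (by omega) (hy i) (hx j)

theorem commProd_one (d : ℕ) : commProd d 1 = 1 := by
  simp [commProd]

theorem commProd_mulSingle (d : ℕ) (i : Fin 4) (h : JenningsGroup ℤ) :
    commProd d (Pi.mulSingle i h) = ⁅mono (d + i) (1 : ℤ), h⁆ := by
  fin_cases i <;> simp [commProd, List.finRange_succ, Pi.mulSingle_apply]

/-- Approximate multiplicativity collapses an arbitrary product of these commutators to four factors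
with fixed first entries. Only the second entries then vary, and they can converge. -/
theorem exists_mk_eq_commProd {d n E : ℕ} (hn : n ≤ 2 * E + d) {z : JenningsGroup ℤ}
    (hz : z ∈ monoCommutators d E) : ∃ h : Fin 4 → JenningsGroup ℤ, (∀ i, h i ∈ filt ℤ E) ∧
      (z : JenningsGroup ℤ ⧸ filt ℤ n) = commProd d h := by
  induction hz using Subgroup.closure_induction with
  | mem z hz =>
    obtain ⟨i, hi, h, -, hE, rfl⟩ := hz
    refine ⟨Pi.mulSingle ⟨i, hi⟩ h, fun j => ?_, by rw [commProd_mulSingle]⟩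
    rw [Pi.mulSingle_apply]
    split_ifs
    · exact hE
    · exact one_mem _
  | one => exact ⟨1, fun i => one_mem _, by rw [commProd_one]⟩
  | mul x y _ _ hx hy =>
    obtain ⟨g, hg, hxg⟩ := hx
    obtain ⟨h, hh, hyh⟩ := hy
    exact ⟨g * h, fun i => mul_mem (hg i) (hh i), by
      rw [mk_commProd_mul (by omega) hg hh, QuotientGroup.mk_mul, hxg, hyh]⟩
  | inv x _ hx =>
    obtain ⟨g, hg, hxg⟩ := hx
    refine ⟨g⁻¹, fun i => inv_mem (hg i), ?_⟩
    rw [QuotientGroup.mk_inv, hxg, _root_.inv_eq_iff_mul_eq_one,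
      ← mk_commProd_mul (by omega) hg (h := g⁻¹) (fun i => inv_mem (hg i)), mul_inv_cancel,
      commProd_one, QuotientGroup.mk_one]

/-- With second entries of depth `E = m - 2 * d - 4`, the requirement `m + 1 ≤ 2 * E + d` is exactly
`3 * d + 9 ≤ m`. -/
theorem exists_commProd_of_mem_filt {d m : ℕ} (hd : 4 ≤ d) (hm : 3 * d + 9 ≤ m)
    {t : JenningsGroup ℤ} (ht : t ∈ filt ℤ m) : ∃ h : Fin 4 → JenningsGroup ℤ,
      (∀ i, h i ∈ filt ℤ (m - 2 * d - 4)) ∧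
        (t : JenningsGroup ℤ ⧸ filt ℤ (m + 1)) = commProd d h := by
  obtain ⟨w, hw, hwm, hw1⟩ := exists_leading_coeff_one hd (by omega)
    (good_of_le (show 3 * d + 6 ≤ m by omega))
  obtain ⟨h, hh, hwh⟩ := exists_mk_eq_commProd (n := m + 1) (by omega)
    (zpow_mem hw (coeff (m + 1) t.toSeries))
  refine ⟨h, hh, ?_⟩
  rw [← hwh, ← mul_inv_eq_one, ← QuotientGroup.mk_inv, ← QuotientGroup.mk_mul,
    QuotientGroup.eq_one_iff]
  refine mul_inv_mem_filt_succ (by omega) ht (zpow_mem hwm _) ?_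
  rw [coeff_zpow hwm (by omega) (by omega), hw1, mul_one, Int.cast_id]

/-- Every series of large depth is a product of four commutators. -/
theorem filt_le_commutator {d : ℕ} (hd : 4 ≤ d) :
    filt ℤ (3 * d + 9) ≤ ⁅filt ℤ d, filt ℤ d⁆ := by
  intro t ht
  -- Successive approximation: `g` is corrected by an `h` of depth `d + 5 + n`, so the second
  -- entries form a Cauchy sequence. Depth `d + 5` is what makes `mk_commProd_mul` precise enough to
  -- gain one coefficient of `t` each time.
  have step : ∀ (n : ℕ) (g : {g : Fin 4 → JenningsGroup ℤ // (∀ i, g i ∈ filt ℤ (d + 5)) ∧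
      (t : JenningsGroup ℤ ⧸ filt ℤ (3 * d + 9 + n)) = commProd d g}),
      ∃ g' : {g : Fin 4 → JenningsGroup ℤ // (∀ i, g i ∈ filt ℤ (d + 5)) ∧
        (t : JenningsGroup ℤ ⧸ filt ℤ (3 * d + 9 + (n + 1))) = commProd d g},
      ∀ i, (g.1 i : JenningsGroup ℤ ⧸ filt ℤ (d + 5 + n)) = g'.1 i := by
    rintro n ⟨g, hg, hgt⟩
    rw [eq_comm, QuotientGroup.eq] at hgt
    obtain ⟨h, hh, hth⟩ := exists_commProd_of_mem_filt hd (by omega) hgt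
    refine ⟨⟨g * h, fun i => mul_mem (hg i) (filt_anti (by omega) (hh i)), ?_⟩, fun i => ?_⟩
    · rw [mk_commProd_mul (by omega) hg hh]
      have : ((t : JenningsGroup ℤ) : JenningsGroup ℤ ⧸ filt ℤ (3 * d + 9 + n + 1)) =
          commProd d g * commProd d h := by
        rw [← hth, QuotientGroup.mk_mul, QuotientGroup.mk_inv, mul_inv_cancel_left]
      exact this
    · rw [QuotientGroup.eq]
      change (g i)⁻¹ * (g i * h i) ∈ _
      rw [inv_mul_cancel_left]
      exact filt_anti (by omega) (hh i)
  choose next hnext using step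
  let s : ∀ n, {g : Fin 4 → JenningsGroup ℤ // (∀ i, g i ∈ filt ℤ (d + 5)) ∧
      (t : JenningsGroup ℤ ⧸ filt ℤ (3 * d + 9 + n)) = commProd d g} := fun n =>
    Nat.rec ⟨1, fun _ => one_mem _, by
      rw [commProd_one, QuotientGroup.mk_one, QuotientGroup.eq_one_iff]; exact ht⟩ next n
  have hl := fun i => exists_limit (e := d + 5) (fun n => (s n).1 i) (fun n => hnext n (s n) i)
  choose l hl using hl
  have hl0 : ∀ i, l i ∈ filt ℤ d := by
    intro i
    have h := QuotientGroup.eq.1 (hl i 0)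
    have h' := filt_anti (show d ≤ d + 5 + 0 by omega)
      (mul_mem (show (s 0).1 i ∈ filt ℤ (d + 5 + 0) from (s 0).2.1 i) h)
    rwa [mul_inv_cancel_left] at h'
  have ht' : t = commProd d l := by
    rw [← mul_inv_eq_one]
    refine eq_one_of_forall_mem_filt fun n => filt_anti (show n ≤ d + 5 + n by omega) ?_
    rw [← QuotientGroup.eq_one_iff, QuotientGroup.mk_mul, QuotientGroup.mk_inv, mul_inv_eq_one]
    have h1 : (t : JenningsGroup ℤ ⧸ filt ℤ (d + 5 + n)) = commProd d (s n).1 := by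
      have h := (s n).2.2
      rw [QuotientGroup.eq] at h ⊢
      exact filt_anti (by omega) h
    rw [h1, mk_commProd, mk_commProd]
    congr 2
    funext i
    rw [hl i n]
  rw [ht', commProd]
  refine Subgroup.list_prod_mem _ ?_
  simp only [List.mem_map]
  rintro _ ⟨i, -, rfl⟩
  exact Subgroup.commutator_mem_commutator (filt_anti (by omega) (mono_mem_filt _)) (hl0 i)

/-! ### The square root of the derivative in characteristic two -/

/-- Reduction of the coefficients along a ring homomorphism. -/
noncomputable def map {R S : Type*} [CommRing R] [CommRing S] (φ : R →+* S) :
    JenningsGroup R →* JenningsGroup S :=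
  MonoidHom.mk' (fun f => ⟨PowerSeries.map φ f.toSeries, by rw [coeff_map, f.coeff_zero, map_zero],
    by rw [coeff_map, f.coeff_one, map_one]⟩) (fun f g => by
      ext1
      simp only [toSeries_mul]
      exact PowerSeries.map_subst g.hasSubst f.toSeries)

theorem coeff_map_toSeries {R S : Type*} [CommRing R] [CommRing S] (φ : R →+* S)
    (f : JenningsGroup R) (n : ℕ) : coeff n (map φ f).toSeries = φ (coeff n f.toSeries) :=
  coeff_map φ n f.toSeries

theorem map_mem_filt {R S : Type*} [CommRing R] [CommRing S] (φ : R →+* S) {n : ℕ}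
    {f : JenningsGroup R} (hf : f ∈ filt R n) : map φ f ∈ filt S n := fun i h2 hi => by
  rw [coeff_map_toSeries, hf i h2 hi, map_zero]

theorem coeff_mul_of_X_pow_dvd {R : Type*} [CommRing R] {a b : ℕ} {P Q : R⟦X⟧}
    (hP : (X : R⟦X⟧) ^ a ∣ P) (hQ : (X : R⟦X⟧) ^ b ∣ Q) (j : ℕ) :
    coeff (a + b + j) (P * Q) =
      ∑ i ∈ Finset.range (j + 1), coeff (a + i) P * coeff (b + (j - i)) Q := by
  obtain ⟨p, rfl⟩ := hP
  obtain ⟨q, rfl⟩ := hQ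
  rw [show X ^ a * p * (X ^ b * q) = X ^ (a + b) * (p * q) by ring, add_comm (a + b) j,
    coeff_X_pow_mul, coeff_mul, Finset.Nat.sum_antidiagonal_eq_sum_range_succ
      (fun i k => coeff i p * coeff k q)]
  refine Finset.sum_congr rfl fun i _ => ?_
  rw [add_comm a i, add_comm b, coeff_X_pow_mul, coeff_X_pow_mul]

theorem two_eq_zero_powerSeries : (2 : (ZMod 2)⟦X⟧) = 0 := by
  rw [← map_ofNat (C (R := ZMod 2)) 2, show (OfNat.ofNat 2 : ZMod 2) = 0 from rfl, map_zero]

/-- Squaring is additive in characteristic two and fixes the elements of `ZMod 2`. Peeling off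
constant terms proves the identity modulo every power of `X`. -/
theorem sq_eq_expand (P : (ZMod 2)⟦X⟧) : P ^ 2 = expand 2 two_ne_zero P := by
  have h : ∀ (n : ℕ) (P : (ZMod 2)⟦X⟧), X ^ n ∣ P ^ 2 - expand 2 two_ne_zero P := by
    intro n
    induction n with
    | zero => intro P; simp
    | succ n ih =>
      intro P
      obtain ⟨Q, hQ⟩ : X ∣ P - C (constantCoeff P) := by
        rw [X_dvd_iff]; simp
      obtain ⟨S, hS⟩ := ih Q
      have hP : P = C (constantCoeff P) + X * Q := by linear_combination hQ
      have hc : ∀ c : ZMod 2, c ^ 2 = c := by decide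
      have hC : (C (constantCoeff P) : (ZMod 2)⟦X⟧) ^ 2 = C (constantCoeff P) := by
        rw [← map_pow, hc]
      have he : expand 2 two_ne_zero P = C (constantCoeff P) + X ^ 2 * expand 2 two_ne_zero Q := by
        conv_lhs => rw [hP]
        rw [map_add, map_mul, expand_C, expand_X]
      refine ⟨X * S, ?_⟩
      rw [he]
      conv_lhs => rw [hP]
      simp only [map_add, map_mul, constantCoeff_C, constantCoeff_X, zero_mul, add_zero]
      linear_combination hC + X ^ 2 * hS + C (constantCoeff P) * X * Q * two_eq_zero_powerSeries
  ext n
  have := X_pow_dvd_iff.1 (h (n + 1) P) n (by omega)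
  rw [map_sub] at this
  linear_combination this

theorem sq_injective_powerSeries {P Q : (ZMod 2)⟦X⟧} (h : P ^ 2 = Q ^ 2) : P = Q := by
  have h1 : (P - Q) ^ 2 = 0 := by
    linear_combination h - Q * (P - Q) * two_eq_zero_powerSeries
  exact sub_eq_zero.1 (pow_eq_zero_iff two_ne_zero |>.1 h1)

/-- The series whose square is the derivative of `f`, in characteristic two. -/
noncomputable def halfDeriv (f : JenningsGroup (ZMod 2)) : (ZMod 2)⟦X⟧ :=
  PowerSeries.mk fun j => coeff (2 * j + 1) f.toSeries

theorem halfDeriv_sq (f : JenningsGroup (ZMod 2)) :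
    halfDeriv f ^ 2 = d⁄dX (ZMod 2) f.toSeries := by
  rw [sq_eq_expand]
  ext n
  rw [coeff_expand, coeff_derivative]
  rcases Nat.even_or_odd' n with ⟨j, rfl | rfl⟩
  · rw [if_pos (Dvd.intro _ rfl), Nat.mul_div_cancel_left _ two_pos, halfDeriv, coeff_mk]
    push_cast
    rw [show (2 : ZMod 2) = 0 from rfl]
    ring
  · rw [if_neg (by omega)]
    push_cast
    rw [show (2 : ZMod 2) * j + 1 + 1 = 2 * (j + 1) by ring, show (2 : ZMod 2) = 0 from rfl]
    ring

/-- The cocycle property of `halfDeriv`. -/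
theorem halfDeriv_mul (f g : JenningsGroup (ZMod 2)) :
    halfDeriv (f * g) = (halfDeriv f).subst g.toSeries * halfDeriv g := by
  apply sq_injective_powerSeries
  rw [mul_pow, ← subst_pow g.hasSubst, halfDeriv_sq, halfDeriv_sq, halfDeriv_sq, toSeries_mul,
    derivative_subst g.hasSubst]

theorem X_pow_dvd_halfDeriv_sub_one {d e : ℕ} (he : 2 * e ≤ d + 1) {f : JenningsGroup (ZMod 2)}
    (hf : f ∈ filt (ZMod 2) d) : X ^ e ∣ halfDeriv f - 1 := by
  rw [X_pow_dvd_iff]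
  intro j hj
  rw [map_sub, halfDeriv, coeff_mk, PowerSeries.coeff_one]
  split_ifs with h
  · subst h
    rw [f.coeff_one, sub_self]
  · rw [sub_zero]
    exact hf _ (by omega) (by omega)

/-- The cocycle identity for `⁅f, g⁆ * (g * f) = f * g` is solved for the first factor. The
precision in `halfDeriv` doubles when translated into coefficient indices, so it goes beyond the
reach of the Wronskian. -/
theorem halfDeriv_commutator {d e : ℕ} (he : 2 * e ≤ d + 1) (he1 : 1 ≤ e)
    {f g : JenningsGroup (ZMod 2)} (hf : f ∈ filt (ZMod 2) d) (hg : g ∈ filt (ZMod 2) d) :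
    X ^ (d + 2 * e) ∣ halfDeriv ⁅f, g⁆ - 1 -
      (d⁄dX (ZMod 2) (halfDeriv f) * (g.toSeries - X) -
        d⁄dX (ZMod 2) (halfDeriv g) * (f.toSeries - X)) := by
  set P := halfDeriv f - 1 with hP
  set Q := halfDeriv g - 1 with hQ
  set B := halfDeriv ⁅f, g⁆ - 1 with hB
  have hPe : X ^ e ∣ P := X_pow_dvd_halfDeriv_sub_one he hf
  have hQe : X ^ e ∣ Q := X_pow_dvd_halfDeriv_sub_one he hg
  have hone : ∀ h : JenningsGroup (ZMod 2), (1 : (ZMod 2)⟦X⟧).subst h.toSeries = 1 := fun h => by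
    rw [← coe_substAlgHom h.hasSubst, map_one]
  have hz : ⁅f, g⁆ * (g * f) = f * g := by rw [commutatorElement_def]; group
  have hmain := congrArg halfDeriv hz
  rw [halfDeriv_mul, halfDeriv_mul, halfDeriv_mul,
    show halfDeriv ⁅f, g⁆ = B + 1 by rw [hB]; ring, show halfDeriv f = P + 1 by rw [hP]; ring,
    show halfDeriv g = Q + 1 by rw [hQ]; ring, subst_add (g * f).hasSubst,
    subst_add f.hasSubst, subst_add g.hasSubst, hone, hone, hone] at hmain
  obtain ⟨δ, hδ⟩ := X_pow_dvd_subst_sub_self hg hPe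
  obtain ⟨ε, hε⟩ := X_pow_dvd_subst_sub_self hf hQe
  set B' := B.subst (g * f).toSeries with hB'
  set P' := P.subst g.toSeries with hP'
  set Q' := Q.subst f.toSeries with hQ'
  obtain ⟨p, hp⟩ := hPe
  obtain ⟨q, hq⟩ := hQe
  have hU : ∃ v, Q' + P + Q' * P = X ^ e * v :=
    ⟨q + X ^ d * ε + p + (q + X ^ d * ε) * X ^ e * p, by
      rw [show Q' = Q + X ^ (e + d) * ε by linear_combination hε, hp, hq]; ring⟩
  obtain ⟨v, hv⟩ := hU
  have hBU : B' * (1 + X ^ e * v) = X ^ (e + d) * (δ * (1 + Q) - ε * (1 + P)) := by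
    linear_combination hmain - B' * hv + (1 + Q) * hδ - (1 + P) * hε
  -- The factor coming from `g * f` is one plus higher terms, so it does not affect the order of
  -- vanishing.
  have hunit : IsUnit (1 + X ^ e * v : (ZMod 2)⟦X⟧) := by
    rw [isUnit_iff_constantCoeff]
    simp [show e ≠ 0 by omega]
  have hBd : X ^ (e + d) ∣ B' := by
    rw [← hunit.dvd_mul_right, hBU]
    exact Dvd.intro _ rfl
  have hBd' : X ^ (e + d) ∣ B := (X_pow_dvd_subst_iff (g * f)).1 hBd
  have h1 := (pow_dvd_pow _ (show d + 2 * e ≤ e + d + d by omega)).trans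
    (X_pow_dvd_subst_sub_self (mul_mem hg hf) hBd')
  have h2 : X ^ (d + 2 * e) ∣ B' - ((P' - P) - (Q' - Q)) := by
    obtain ⟨b, hb⟩ := hBd
    refine ⟨-b * v + δ * q - ε * p, ?_⟩
    rw [hδ, hε]
    linear_combination hBU - X ^ e * v * hb + X ^ (e + d) * δ * hq - X ^ (e + d) * ε * hp
  have h3 := (pow_dvd_pow _ (show d + 2 * e ≤ e + 2 * d by omega)).trans
    (taylor hg (X_pow_dvd_halfDeriv_sub_one he hf))
  have h4 := (pow_dvd_pow _ (show d + 2 * e ≤ e + 2 * d by omega)).trans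
    (taylor hf (X_pow_dvd_halfDeriv_sub_one he hg))
  have e1 : d⁄dX (ZMod 2) (halfDeriv f) = d⁄dX (ZMod 2) (halfDeriv f - 1) := by
    rw [map_sub, derivative_one, sub_zero]
  have e2 : d⁄dX (ZMod 2) (halfDeriv g) = d⁄dX (ZMod 2) (halfDeriv g - 1) := by
    rw [map_sub, derivative_one, sub_zero]
  rw [e1, e2]
  refine Eq.mp (congrArg _ ?_) (dvd_sub (dvd_add h2 (dvd_sub h3 h4)) h1)
  ring

/-! ### Coefficients of commutators -/

section Coefficients

variable {d : ℕ} {f g : JenningsGroup ℤ}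

theorem X_pow_dvd_derivative_succ {R : Type*} [CommRing R] {m : ℕ} {P : R⟦X⟧}
    (h : (X : R⟦X⟧) ^ (m + 1) ∣ P) : (X : R⟦X⟧) ^ m ∣ d⁄dX R P := by
  rw [X_pow_dvd_iff] at h ⊢
  intro j hj
  rw [coeff_derivative, h _ (by omega), zero_mul]

theorem coeff_sub_X {R : Type*} [CommRing R] (P : R⟦X⟧) {n : ℕ} (hn : 2 ≤ n) :
    coeff n (P - X) = coeff n P := by
  rw [map_sub, coeff_X, if_neg (by omega), sub_zero]

theorem coeff_commutator (hd : 1 ≤ d) (hf : f ∈ filt ℤ d) (hg : g ∈ filt ℤ d) {j : ℕ}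
    (hj : j < d) : coeff (2 * d + 1 + j) ⁅f, g⁆.toSeries =
      ∑ i ∈ Finset.range (j + 1), ((d + i + 1 : ℤ) *
        (coeff (d + 1 + i) f.toSeries * coeff (d + 1 + (j - i)) g.toSeries -
          coeff (d + 1 + i) g.toSeries * coeff (d + 1 + (j - i)) f.toSeries)) := by
  rw [coeff_eq_of_dvd (commutator_wronskian hf hg) (by omega) (by omega), map_sub,
    show 2 * d + 1 + j = d + (d + 1) + j by ring,
    coeff_mul_of_X_pow_dvd (X_pow_dvd_derivative_succ (mem_filt.1 hf)) (mem_filt.1 hg),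
    coeff_mul_of_X_pow_dvd (X_pow_dvd_derivative_succ (mem_filt.1 hg)) (mem_filt.1 hf),
    ← Finset.sum_sub_distrib]
  refine Finset.sum_congr rfl fun i _ => ?_
  rw [coeff_derivative, coeff_derivative, coeff_sub_X _ (by omega), coeff_sub_X _ (by omega),
    coeff_sub_X _ (by omega), coeff_sub_X _ (by omega), add_right_comm d i 1]
  push_cast
  ring

/-- The Wronskian-like terms for `halfDeriv` have order at least `d + e`. -/
theorem cast_coeff_commutator_eq_zero {e n : ℕ} (he : 2 * e ≤ d + 1) (he1 : 1 ≤ e)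
    (hf : f ∈ filt ℤ d) (hg : g ∈ filt ℤ d) (hn1 : 1 ≤ n) (hn : n < d + e) :
    ((coeff (2 * n + 1) ⁅f, g⁆.toSeries : ℤ) : ZMod 2) = 0 := by
  set φ := Int.castRingHom (ZMod 2)
  have hf' := map_mem_filt φ hf
  have hg' := map_mem_filt φ hg
  have h := X_pow_dvd_iff.1 (halfDeriv_commutator he he1 hf' hg') n (by omega)
  have hz : ∀ {f g : JenningsGroup (ZMod 2)}, f ∈ filt (ZMod 2) d → g ∈ filt (ZMod 2) d →
      coeff n (d⁄dX (ZMod 2) (halfDeriv f) * (g.toSeries - X)) = 0 := by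
    intro f g hf hg
    obtain ⟨p, hp⟩ := X_pow_dvd_derivative (X_pow_dvd_halfDeriv_sub_one he hf)
    obtain ⟨q, hq⟩ := mem_filt.1 hg
    rw [map_sub, derivative_one, sub_zero] at hp
    refine X_pow_dvd_iff.1 (?_ : X ^ (d + e) ∣ _) n hn
    exact ⟨p * q, by rw [hq]; linear_combination X ^ d * q * hp⟩
  rw [map_sub, map_sub, map_sub, hz hf' hg', hz hg' hf', PowerSeries.coeff_one,
    if_neg (by omega), halfDeriv, coeff_mk, ← map_commutatorElement, coeff_map_toSeries] at h
  simpa using h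

/-- The same congruence in the next `e` degrees, where the Wronskian-like terms first contribute. -/
theorem cast_coeff_commutator {e j : ℕ} (he : 2 * e ≤ d + 1) (he1 : 1 ≤ e)
    (hf : f ∈ filt ℤ d) (hg : g ∈ filt ℤ d) (hj : j < e) :
    ((coeff (2 * (d + e + j) + 1) ⁅f, g⁆.toSeries : ℤ) : ZMod 2) =
      ((∑ i ∈ Finset.range (j + 1), ((e + i : ℤ) *
        (coeff (2 * (e + i) + 1) f.toSeries * coeff (d + 1 + (j - i)) g.toSeries -
          coeff (2 * (e + i) + 1) g.toSeries * coeff (d + 1 + (j - i)) f.toSeries)) : ℤ) :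
            ZMod 2) := by
  obtain ⟨e, rfl⟩ : ∃ e', e = e' + 1 := ⟨e - 1, by omega⟩
  set φ := Int.castRingHom (ZMod 2)
  have hf' := map_mem_filt φ hf
  have hg' := map_mem_filt φ hg
  have h := X_pow_dvd_iff.1 (halfDeriv_commutator he he1 hf' hg') (d + (e + 1) + j) (by omega)
  have hD : ∀ {f : JenningsGroup (ZMod 2)}, f ∈ filt (ZMod 2) d →
      X ^ e ∣ d⁄dX (ZMod 2) (halfDeriv f) := by
    intro f hf
    have h := X_pow_dvd_derivative_succ (X_pow_dvd_halfDeriv_sub_one he hf)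
    rwa [map_sub, derivative_one, sub_zero] at h
  rw [map_sub, map_sub, map_sub, PowerSeries.coeff_one, if_neg (by omega),
    show coeff (d + (e + 1) + j) (halfDeriv ⁅map φ f, map φ g⁆) =
      φ (coeff (2 * (d + (e + 1) + j) + 1) ⁅f, g⁆.toSeries) by
        rw [halfDeriv, coeff_mk, ← map_commutatorElement, coeff_map_toSeries],
    show d + (e + 1) + j = e + (d + 1) + j by ring,
    coeff_mul_of_X_pow_dvd (hD hf') (mem_filt.1 hg'),
    coeff_mul_of_X_pow_dvd (hD hg') (mem_filt.1 hf'), sub_zero, sub_eq_zero,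
    ← Finset.sum_sub_distrib] at h
  rw [show d + (e + 1) + j = e + (d + 1) + j by ring]
  refine Eq.trans h ?_
  push_cast
  refine Finset.sum_congr rfl fun i _ => ?_
  rw [coeff_derivative, coeff_derivative, coeff_sub_X _ (by omega), coeff_sub_X _ (by omega),
    halfDeriv, halfDeriv, coeff_mk, coeff_mk, coeff_map_toSeries, coeff_map_toSeries,
    coeff_map_toSeries, coeff_map_toSeries, add_right_comm e i 1]
  simp only [φ, eq_intCast]
  push_cast
  ring

end Coefficients

/-! ### Torsion of the abelianization -/

section Torsion

variable {d : ℕ}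

theorem mk_eq_one_of_mem_commutator {z : JenningsGroup ℤ} (h : z ∈ ⁅filt ℤ d, filt ℤ d⁆)
    (hz : z ∈ filt ℤ d) : Abelianization.of (⟨z, hz⟩ : filt ℤ d) = 1 := by
  rw [← MonoidHom.mem_ker, Abelianization.ker_of]
  rw [← Subgroup.map_subtype_commutator] at h
  obtain ⟨y, hy, rfl⟩ := h
  exact hy

theorem mem_commutator_of_mk_eq_one {z : filt ℤ d} (h : Abelianization.of z = 1) :
    z.1 ∈ ⁅filt ℤ d, filt ℤ d⁆ := by
  rw [← MonoidHom.mem_ker, Abelianization.ker_of] at h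
  rw [← Subgroup.map_subtype_commutator]
  exact ⟨z, h, rfl⟩

/-- The images in the abelianization of the series of depth at least `2 * d + 1` are the products
of the classes of `x + x ^ (j + 1)`, for `j` in a subset of any finite set `L` off which
commutators realize all leading terms. -/
theorem exists_finset_prod (hd : 4 ≤ d) {L : Finset ℕ} (hL : ∀ m, 2 * d + 1 ≤ m → m ∉ L → Good d m)
    {ε : ℕ → Abelianization (filt ℤ d)}
    (hε : ∀ j (hj : mono j (1 : ℤ) ∈ filt ℤ d), ε j = Abelianization.of ⟨mono j 1, hj⟩)
    (k m : ℕ) (hm : 2 * d + 1 ≤ m) (hk : 3 * d + 9 ≤ m + k) (t : filt ℤ d) (ht : t.1 ∈ filt ℤ m) :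
    ∃ S ⊆ L, (∀ j ∈ S, m ≤ j) ∧ Abelianization.of t = ∏ j ∈ S, ε j := by
  induction k generalizing m t with
  | zero =>
    refine ⟨∅, Finset.empty_subset _, by simp, ?_⟩
    rw [Finset.prod_empty]
    exact mk_eq_one_of_mem_commutator (filt_le_commutator hd (filt_anti (by omega) ht)) t.2
  | succ k ih =>
    by_cases hmL : m ∈ L
    -- Divide the leading coefficient by two: the quotient is absorbed by `w`, whose class is
    -- trivial, and the remainder decides whether `m` enters `S`.
    · obtain ⟨w, hw, hwm, hw2⟩ := exists_leading_coeff_two hd hm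
      set c := coeff (m + 1) t.1.toSeries with hc
      have hwd := filt_anti (show d ≤ m by omega) hwm
      have hmono := filt_anti (show d ≤ m by omega) (mono_mem_filt (n := m) (1 : ℤ))
      have hwq := zpow_mem hwm (c / 2)
      have hmr := zpow_mem (mono_mem_filt (n := m) (1 : ℤ)) (c % 2)
      set t' : filt ℤ d := t * ((⟨w, hwd⟩ : filt ℤ d) ^ (c / 2) *
        (⟨mono m 1, hmono⟩ : filt ℤ d) ^ (c % 2))⁻¹ with ht'
      obtain ⟨S, hSL, hS, hSt⟩ := ih (m + 1) (by omega) (by omega) t' (by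
        refine mul_inv_mem_filt_succ (by omega) ht (mul_mem hwq hmr) ?_
        change _ = coeff (m + 1) (w ^ (c / 2) * mono m 1 ^ (c % 2)).toSeries
        rw [coeff_mul_of_mem_filt hwq hmr (by omega) (by omega),
          coeff_zpow hwm (by omega) (by omega),
          coeff_zpow (mono_mem_filt _) (by omega) (by omega), hw2,
          coeff_mono (by omega) _ (by omega), if_pos rfl, mul_one, Int.cast_id, Int.cast_id,
          mul_comm, Int.mul_ediv_add_emod])
      have hmS : m ∉ S := fun h => by have := hS m h; omega
      have key : Abelianization.of t = Abelianization.of t' * ε m ^ (c % 2) := by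
        rw [ht', map_mul, map_inv, map_mul, map_zpow, map_zpow, ← hε m hmono,
          mk_eq_one_of_mem_commutator (monoCommutators_le hw), one_zpow, one_mul,
          inv_mul_cancel_right]
      rcases Int.emod_two_eq_zero_or_one c with h0 | h1
      · exact ⟨S, hSL, fun j hj => by have := hS j hj; omega, by
          rw [key, h0, zpow_zero, mul_one, hSt]⟩
      · refine ⟨insert m S, Finset.insert_subset hmL hSL, fun j hj => ?_, ?_⟩
        · rcases Finset.mem_insert.1 hj with rfl | hj
          · exact le_rfl
          · have := hS j hj; omega
        · rw [key, h1, zpow_one, hSt, Finset.prod_insert hmS, mul_comm]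
    · obtain ⟨w, hw, hwm, hw1⟩ := exists_leading_coeff_one hd hm (hL m hm hmL)
      set c := coeff (m + 1) t.1.toSeries with hc
      have hwd := filt_anti (show d ≤ m by omega) hwm
      set t' : filt ℤ d := t * ((⟨w, hwd⟩ : filt ℤ d) ^ c)⁻¹ with ht'
      obtain ⟨S, hSL, hS, hSt⟩ := ih (m + 1) (by omega) (by omega) t' (by
        refine mul_inv_mem_filt_succ (by omega) ht (zpow_mem hwm c) ?_
        change _ = coeff (m + 1) (w ^ c).toSeries
        rw [coeff_zpow hwm (by omega) (by omega), hw1, mul_one, Int.cast_id])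
      refine ⟨S, hSL, fun j hj => by have := hS j hj; omega, ?_⟩
      rw [← hSt, ht', map_mul, map_inv, map_zpow,
        mk_eq_one_of_mem_commutator (monoCommutators_le hw), one_zpow, inv_one, mul_one]

/-- The natural map from series of depth at least `2 * d + 1` to the abelianization. -/
noncomputable def toAb (d : ℕ) : filt ℤ (2 * d + 1) →* Abelianization (filt ℤ d) :=
  Abelianization.of.comp (Subgroup.inclusion (filt_anti (by omega)))

theorem card_range_toAb_le (hd : 4 ≤ d) {L : Finset ℕ}
    (hL : ∀ m, 2 * d + 1 ≤ m → m ∉ L → Good d m) :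
    Finite (toAb d).range ∧ Nat.card (toAb d).range ≤ 2 ^ L.card := by
  classical
  let ε : ℕ → Abelianization (filt ℤ d) := fun j =>
    if hj : mono j (1 : ℤ) ∈ filt ℤ d then Abelianization.of ⟨mono j 1, hj⟩ else 1
  have hsub : ((toAb d).range : Set (Abelianization (filt ℤ d))) ⊆
      (L.powerset.image fun S => ∏ j ∈ S, ε j : Finset _) := by
    rintro _ ⟨t, rfl⟩
    obtain ⟨S, hSL, -, hS⟩ := exists_finset_prod hd hL (ε := ε) (fun j hj => dif_pos hj) (3 * d + 9)
      (2 * d + 1) le_rfl (by omega) (Subgroup.inclusion (filt_anti (by omega)) t) t.2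
    rw [Finset.mem_coe, Finset.mem_image]
    exact ⟨S, Finset.mem_powerset.2 hSL, hS.symm⟩
  refine ⟨(Finset.finite_toSet _).subset hsub, ?_⟩
  calc Nat.card (toAb d).range
      = Set.ncard ((toAb d).range : Set (Abelianization (filt ℤ d))) := rfl
    _ ≤ _ := Set.ncard_le_ncard hsub (Finset.finite_toSet _)
    _ ≤ 2 ^ L.card := by
      rw [Set.ncard_coe_finset]
      exact Finset.card_image_le.trans (Finset.card_powerset L).le

/-- If f^n is a commutator product, its coefficients of index up to 2d+1 vanish. On the successive
depths they are n times those of f, so f itself has depth at least 2d+1. -/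
theorem range_toAb_eq_torsion (hd : 1 ≤ d) (hfin : Finite (toAb d).range) :
    (toAb d).range = CommGroup.torsion (Abelianization (filt ℤ d)) := by
  apply le_antisymm
  · intro a ha
    have h := isOfFinOrder_of_finite (⟨a, ha⟩ : (toAb d).range)
    exact (toAb d).range.subtype.isOfFinOrder h
  · intro a ha
    obtain ⟨f, rfl⟩ := QuotientGroup.mk_surjective a
    obtain ⟨n, hn, hfn⟩ := isOfFinOrder_iff_pow_eq_one.1 ((CommGroup.mem_torsion _).1 ha)
    replace hfn : Abelianization.of (f ^ n) = 1 := by rw [map_pow]; exact hfn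
    have hfn' : f.1 ^ n ∈ filt ℤ (2 * d + 1) :=
      commutator_filt_le hd (mem_commutator_of_mk_eq_one (z := f ^ n) hfn)
    have hmem : ∀ j, d + j ≤ 2 * d + 1 → f.1 ∈ filt ℤ (d + j) := by
      intro j
      induction j with
      | zero => exact fun _ => f.2
      | succ j ih =>
        intro hj
        have hf := ih (by omega)
        rw [← add_assoc, mem_filt_succ_iff (by omega) hf]
        have h1 := coeff_zpow hf (j := d + j + 1) (by omega) (by omega) n
        rw [zpow_natCast, coeff_eq_zero_of_mem_filt hfn' (by omega) (by omega)] at h1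
        have hn0 : ((n : ℤ) : ℤ) ≠ 0 := by exact_mod_cast hn.ne'
        exact (mul_eq_zero.1 h1.symm).resolve_left hn0
    have hf := hmem (d + 1) (by omega)
    rw [show d + (d + 1) = 2 * d + 1 by ring] at hf
    exact ⟨⟨f.1, hf⟩, rfl⟩

/-- A criterion computing the torsion of the abelianization. -/
theorem nonempty_torsion_equiv (hd : 4 ≤ d) {V : Type*} [AddCommGroup V]
    (Ψ : filt ℤ (2 * d + 1) →* Multiplicative V) (hsurj : Function.Surjective Ψ)
    (hkill : ∀ z : filt ℤ (2 * d + 1),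
      (∃ f ∈ filt ℤ d, ∃ g ∈ filt ℤ d, ⁅f, g⁆ = z.1) → Ψ z = 1)
    (L : Finset ℕ) (hL : ∀ m, 2 * d + 1 ≤ m → m ∉ L → Good d m)
    (hcard : Nat.card V = 2 ^ L.card) :
    Nonempty (CommGroup.torsion (Abelianization (filt ℤ d)) ≃* Multiplicative V) := by
  obtain ⟨hfin, hle⟩ := card_range_toAb_le hd hL
  have hker : (toAb d).ker ≤ Ψ.ker := by
    intro x hx
    have h1 : x.1 ∈ ⁅filt ℤ d, filt ℤ d⁆ :=
      mem_commutator_of_mk_eq_one (z := Subgroup.inclusion (filt_anti (by omega)) x) hx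
    have h2 : ⁅filt ℤ d, filt ℤ d⁆ ≤ Ψ.ker.map (filt ℤ (2 * d + 1)).subtype :=
      Subgroup.commutator_le.2 fun f hf g hg =>
        ⟨⟨⁅f, g⁆, commutator_mem_filt (by omega) hf hg⟩, hkill _ ⟨f, hf, g, hg, rfl⟩, rfl⟩
    obtain ⟨y, hy, hyx⟩ := h2 h1
    rwa [← Subtype.ext hyx]
  have hker' : (toAb d).ker = Ψ.ker := by
    -- The smaller kernel has index at most `2 ^ L.card`, which is the index of the larger one, so
    -- the relative index is one.
    refine le_antisymm hker (Subgroup.relIndex_eq_one.1 ?_)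
    have h := Subgroup.relIndex_mul_index hker
    have h1 : Ψ.ker.index = 2 ^ L.card := by
      rw [Subgroup.index_ker, MonoidHom.range_eq_top.2 hsurj, Subgroup.card_top,
        ← hcard]
      exact Nat.card_congr Multiplicative.toAdd
    have h2 : (toAb d).ker.index ≠ 0 := by
      rw [Subgroup.index_ker]
      exact Nat.card_pos.ne'
    rw [← Subgroup.index_ker] at hle
    rw [h1] at h
    have hpos : 0 < 2 ^ L.card := by positivity
    rcases Nat.lt_trichotomy ((toAb d).ker.relIndex Ψ.ker) 1 with h3 | h3 | h3
    · rw [Nat.lt_one_iff.1 h3, zero_mul] at h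
      exact absurd h.symm h2
    · exact h3
    · nlinarith
  exact ⟨(MulEquiv.subgroupCongr (range_toAb_eq_torsion (by omega) hfin)).symm.trans
    ((QuotientGroup.quotientKerEquivRange (toAb d)).symm.trans
      ((QuotientGroup.quotientMulEquivOfEq hker').trans
        (QuotientGroup.quotientKerEquivOfSurjective Ψ hsurj)))⟩

end Torsion

/-! ### Homomorphisms built from coefficients -/

section Invariants

variable {d : ℕ}

theorem exists_coeff_eq (d : ℕ) (c : ℕ → ℤ) : ∃ f : filt ℤ (2 * d + 1),
    ∀ j, 2 * d + 2 ≤ j → coeff j f.1.toSeries = c j := by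
  obtain ⟨f, hf⟩ := exists_toSeries_eq_X_add (show 1 ≤ 2 * d + 1 by omega)
    (PowerSeries.mk fun j => c (j + (2 * d + 2)))
  refine ⟨⟨f, ?_⟩, fun j hj => ?_⟩
  · rw [mem_filt, hf, add_sub_cancel_left]
    exact Dvd.intro _ rfl
  · obtain ⟨i, rfl⟩ := Nat.exists_eq_add_of_le' hj
    change coeff _ f.toSeries = _
    rw [hf, map_add, coeff_X_pow_mul, coeff_mk, coeff_X, if_neg (by omega), zero_add]

/-- Coefficients modulo two at the depths `2 * d + 2 + 2 * i`, one of them corrected by the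
leading coefficient. -/
noncomputable def coeffsModTwo (d r : ℕ) (hr : 2 * d + 1 + 2 * r ≤ 4 * d + 2) :
    filt ℤ (2 * d + 1) →* Multiplicative (Fin r → ZMod 2) :=
  MonoidHom.mk' (fun f => Multiplicative.ofAdd fun i =>
    ((coeff (2 * d + 3 + 2 * i) f.1.toSeries +
      if i.1 = d / 2 then coeff (2 * d + 2) f.1.toSeries else 0 : ℤ) : ZMod 2)) (fun f g => by
    rw [← ofAdd_add]
    congr 1
    funext i
    have hi := i.2
    rw [Pi.add_apply, Subgroup.coe_mul, coeff_mul_of_mem_filt f.2 g.2 (by omega) (by omega),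
      coeff_mul_of_mem_filt f.2 g.2 (by omega) (by omega)]
    split_ifs <;> push_cast <;> ring)

/-- A coefficient modulo four, corrected by twice another one, and some coefficients modulo two. -/
noncomputable def coeffsModFour (d : ℕ) {r : ℕ} (A B : ℕ) (τ : Fin r → ℕ)
    (hA : 2 ≤ A ∧ A ≤ 4 * d + 2) (hB : 2 ≤ B ∧ B ≤ 4 * d + 2)
    (hτ : ∀ i, 2 ≤ τ i ∧ τ i ≤ 4 * d + 2) :
    filt ℤ (2 * d + 1) →* Multiplicative (ZMod 4 × (Fin r → ZMod 2)) :=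
  MonoidHom.mk' (fun f => Multiplicative.ofAdd
    (((coeff A f.1.toSeries + 2 * coeff B f.1.toSeries : ℤ) : ZMod 4),
      fun i => ((coeff (τ i) f.1.toSeries : ℤ) : ZMod 2))) (fun f g => by
    rw [← ofAdd_add]
    congr 1
    refine Prod.ext ?_ (funext fun i => ?_)
    · simp only [Prod.fst_add]
      rw [Subgroup.coe_mul, coeff_mul_of_mem_filt f.2 g.2 (by omega) hA.1,
        coeff_mul_of_mem_filt f.2 g.2 (by omega) hB.1]
      push_cast
      ring
    · simp only [Prod.snd_add, Pi.add_apply]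
      have := hτ i
      rw [Subgroup.coe_mul, coeff_mul_of_mem_filt f.2 g.2 (by omega) (by omega)]
      push_cast
      ring)

theorem coeffsModTwo_surjective {r : ℕ} (hr : 2 * d + 1 + 2 * r ≤ 4 * d + 2) :
    Function.Surjective (coeffsModTwo d r hr) := by
  intro v
  -- Coefficient `2 * d + 2` is taken to be zero so that the correction term disappears.
  obtain ⟨f, hf⟩ := exists_coeff_eq d (fun j => if j = 2 * d + 2 then 0 else
    if h : (j - (2 * d + 3)) / 2 < r then ((Multiplicative.toAdd v ⟨_, h⟩).val : ℤ) else 0)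
  refine ⟨f, funext fun i => ?_⟩
  have hi := i.2
  change ((coeff (2 * d + 3 + 2 * i) f.1.toSeries +
      if i.1 = d / 2 then coeff (2 * d + 2) f.1.toSeries else 0 : ℤ) : ZMod 2) = v i
  have h1 : (2 * d + 3 + 2 * i.1 - (2 * d + 3)) / 2 = i.1 := by omega
  have h2 : ¬ 2 * d + 3 + 2 * i.1 = 2 * d + 2 := by omega
  rw [hf _ (by omega), hf _ (by omega)]
  simp only [h1, h2, if_true, if_false, ite_self, add_zero]
  rw [dif_pos hi, Int.cast_natCast]
  exact ZMod.natCast_zmod_val _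

theorem coeffsModFour_surjective {r A B : ℕ} {τ : Fin r → ℕ}
    (hA : 2 ≤ A ∧ A ≤ 4 * d + 2) (hB : 2 ≤ B ∧ B ≤ 4 * d + 2)
    (hτ : ∀ i, 2 ≤ τ i ∧ τ i ≤ 4 * d + 2) (hA2 : 2 * d + 2 ≤ A) (hB2 : 2 * d + 2 ≤ B)
    (hτ2 : ∀ i, 2 * d + 2 ≤ τ i) (hAB : A ≠ B) (hAτ : ∀ i, τ i ≠ A) (hBτ : ∀ i, τ i ≠ B)
    (hinj : Function.Injective τ) : Function.Surjective (coeffsModFour d A B τ hA hB hτ) := by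
  classical
  intro v
  obtain ⟨f, hf⟩ := exists_coeff_eq d (fun j => if j = A then ((Multiplicative.toAdd v).1.val : ℤ)
    else if j = B then 0 else if h : ∃ i, τ i = j then
      (((Multiplicative.toAdd v).2 h.choose).val : ℤ) else 0)
  refine ⟨f, Prod.ext ?_ (funext fun i => ?_)⟩
  · change ((coeff A f.1.toSeries + 2 * coeff B f.1.toSeries : ℤ) : ZMod 4) = v.1
    rw [hf _ hA2, hf _ hB2, if_pos rfl, if_neg hAB.symm, if_pos rfl, mul_zero, add_zero,
      Int.cast_natCast]
    exact ZMod.natCast_zmod_val _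
  · change ((coeff (τ i) f.1.toSeries : ℤ) : ZMod 2) = v.2 i
    have h : ∃ i', τ i' = τ i := ⟨i, rfl⟩
    rw [hf _ (hτ2 i), if_neg (hAτ i), if_neg (hBτ i), dif_pos h, hinj h.choose_spec,
      Int.cast_natCast]
    exact ZMod.natCast_zmod_val _

variable {f g : JenningsGroup ℤ}

theorem cast_coeff_commutator_of_odd {e : ℕ} (hde : d = 2 * e) (he : Odd e) (he2 : 2 ≤ e)
    (hf : f ∈ filt ℤ d) (hg : g ∈ filt ℤ d) {i : ℕ} (hi : i ≤ e) :
    ((coeff (2 * d + 3 + 2 * i) ⁅f, g⁆.toSeries +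
      if i = d / 2 then coeff (2 * d + 2) ⁅f, g⁆.toSeries else 0 : ℤ) : ZMod 2) = 0 := by
  obtain ⟨t, rfl⟩ := he
  subst hde
  rcases Nat.lt_trichotomy (i + 1) (2 * t + 1) with h | h | h
  · rw [if_neg (by omega), add_zero]
    have := cast_coeff_commutator_eq_zero (e := 2 * t + 1) (n := 2 * (2 * t + 1) + 1 + i) (by omega)
      (by omega) hf hg (by omega) (by omega)
    rwa [show 2 * (2 * (2 * t + 1) + 1 + i) + 1 = 2 * (2 * (2 * t + 1)) + 3 + 2 * i by ring] at this
  · rw [if_neg (by omega), add_zero]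
    have := cast_coeff_commutator (e := 2 * t + 1) (j := 0) (by omega) (by omega) hf hg (by omega)
    rw [show 2 * (2 * (2 * t + 1) + (2 * t + 1) + 0) + 1 = 2 * (2 * (2 * t + 1)) + 3 + 2 * i by
      omega] at this
    -- The single surviving term is antisymmetric in `f` and `g` with equal indices, because `2 * e
    -- + 1 = d + 1`.
    rw [this]
    simp only [zero_add, Finset.sum_range_one, add_zero, Nat.sub_zero]
    rw [mul_comm (coeff _ g.toSeries), sub_self, mul_zero, Int.cast_zero]
  · rw [if_pos (by omega)]
    -- Here the coefficient need not vanish modulo two, but it agrees with the integral coefficient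
    -- of index `2 * d + 2`: both reduce to the determinant of the first two coefficients of `f` and
    -- `g`. Hence the correction.
    have h1 := cast_coeff_commutator (e := 2 * t + 1) (j := 1) (by omega) (by omega) hf hg
      (by omega)
    have h2 := coeff_commutator (j := 1) (by omega) hf hg (by omega)
    rw [show 2 * (2 * (2 * t + 1) + (2 * t + 1) + 1) + 1 = 2 * (2 * (2 * t + 1)) + 3 + 2 * i by
      omega] at h1
    rw [show 2 * (2 * (2 * t + 1)) + 1 + 1 = 2 * (2 * (2 * t + 1)) + 2 by ring] at h2
    rw [Int.cast_add, h1, h2, ← Int.cast_add]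
    simp only [Finset.sum_range_succ, Finset.sum_range_zero, zero_add, add_zero, Nat.sub_zero,
      Nat.sub_self, Nat.cast_zero, Nat.cast_one]
    refine (ZMod.intCast_zmod_eq_zero_iff_dvd _ 2).2
      ⟨t * (coeff (2 * (2 * t + 1) + 1) f.toSeries *
        coeff (2 * (2 * t + 1) + 1 + 1) g.toSeries - coeff (2 * (2 * t + 1) + 1) g.toSeries *
        coeff (2 * (2 * t + 1) + 1 + 1) f.toSeries) +
        (t + 1) * (coeff (2 * (2 * t + 1 + 1) + 1) f.toSeries *
        coeff (2 * (2 * t + 1) + 1) g.toSeries - coeff (2 * (2 * t + 1 + 1) + 1) g.toSeries *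
        coeff (2 * (2 * t + 1) + 1) f.toSeries), ?_⟩
    push_cast
    ring

end Invariants

/-! ### Vanishing of the invariants on commutators -/

section Vanishing

variable {d t : ℕ} {f g : JenningsGroup ℤ}

theorem cast_coeff_commutator_of_one_mod_four (hd : d = 4 * t + 1) (ht : 1 ≤ t)
    (hf : f ∈ filt ℤ d) (hg : g ∈ filt ℤ d) {i : ℕ} (hi : i ≤ 2 * t + 1) :
    ((coeff (2 * d + 3 + 2 * i) ⁅f, g⁆.toSeries +
      if i = d / 2 then coeff (2 * d + 2) ⁅f, g⁆.toSeries else 0 : ℤ) : ZMod 2) = 0 := by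
  rcases Nat.lt_trichotomy i (2 * t) with h | h | h
  · rw [if_neg (by omega), add_zero]
    have := cast_coeff_commutator_eq_zero (e := 2 * t + 1) (n := d + 1 + i) (by omega)
      (by omega) hf hg (by omega) (by omega)
    rwa [show 2 * (d + 1 + i) + 1 = 2 * d + 3 + 2 * i by ring] at this
  · rw [if_pos (by omega)]
    have h1 := cast_coeff_commutator (e := 2 * t + 1) (j := 0) (by omega) (by omega) hf hg
      (by omega)
    have h2 := coeff_commutator (j := 1) (by omega) hf hg (by omega)
    rw [show 2 * (d + (2 * t + 1) + 0) + 1 = 2 * d + 3 + 2 * i by omega] at h1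
    rw [show 2 * d + 1 + 1 = 2 * d + 2 by ring] at h2
    rw [Int.cast_add, h1, h2, ← Int.cast_add]
    simp only [Finset.sum_range_succ, Finset.sum_range_zero, zero_add, add_zero, Nat.sub_zero,
      Nat.sub_self, Nat.cast_zero, Nat.cast_one]
    rw [show 2 * (2 * t + 1) + 1 = d + 1 + 1 by omega]
    refine (ZMod.intCast_zmod_eq_zero_iff_dvd _ 2).2
      ⟨(t + 1) * (coeff (d + 1 + 1) f.toSeries * coeff (d + 1) g.toSeries -
        coeff (d + 1 + 1) g.toSeries * coeff (d + 1) f.toSeries), ?_⟩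
    push_cast
    ring
  · rw [if_neg (by omega), add_zero]
    have h1 := cast_coeff_commutator (e := 2 * t + 1) (j := 1) (by omega) (by omega) hf hg
      (by omega)
    rw [show 2 * (d + (2 * t + 1) + 1) + 1 = 2 * d + 3 + 2 * i by omega] at h1
    rw [h1]
    simp only [Finset.sum_range_succ, Finset.sum_range_zero, zero_add, add_zero, Nat.sub_zero,
      Nat.sub_self, Nat.cast_zero, Nat.cast_one]
    rw [show 2 * (2 * t + 1) + 1 = d + 1 + 1 by omega]
    refine (ZMod.intCast_zmod_eq_zero_iff_dvd _ 2).2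
      ⟨(t + 1) * (coeff (2 * (2 * t + 1 + 1) + 1) f.toSeries * coeff (d + 1) g.toSeries -
        coeff (2 * (2 * t + 1 + 1) + 1) g.toSeries * coeff (d + 1) f.toSeries), ?_⟩
    push_cast
    ring

/-- For even `e`, the first coefficient on which `halfDeriv` depends also vanishes. -/
theorem cast_coeff_commutator_eq_zero_of_le {e n : ℕ} (he : 2 * e ≤ d + 1) (he1 : 1 ≤ e)
    (hee : Even e) (hf : f ∈ filt ℤ d) (hg : g ∈ filt ℤ d) (hn1 : 1 ≤ n) (hn : n ≤ d + e) :
    ((coeff (2 * n + 1) ⁅f, g⁆.toSeries : ℤ) : ZMod 2) = 0 := by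
  rcases hn.lt_or_eq with h | rfl
  · exact cast_coeff_commutator_eq_zero he he1 hf hg hn1 h
  · have h1 := cast_coeff_commutator (e := e) (j := 0) he he1 hf hg (by omega)
    rw [add_zero] at h1
    obtain ⟨s, rfl⟩ := hee
    rw [h1, Finset.sum_range_one]
    exact (ZMod.intCast_zmod_eq_zero_iff_dvd _ 2).2
      (Dvd.dvd.mul_right (show ((2 : ℕ) : ℤ) ∣ ((s + s : ℕ) : ℤ) + (0 : ℕ) from
        ⟨s, by push_cast; ring⟩) _)

/-- In the Wronskian the middle term cancels and the outer ones combine to twice the determinant of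
the coefficients of indices `d + 3` and `d + 1`. The same determinant is the coefficient of index `3
* d + 3` modulo two. -/
theorem cast_coeff_commutator_of_zero_mod_four (hd : d = 4 * t) (ht : 1 ≤ t)
    (hf : f ∈ filt ℤ d) (hg : g ∈ filt ℤ d) : ((coeff (2 * d + 3) ⁅f, g⁆.toSeries +
      2 * coeff (3 * d + 3) ⁅f, g⁆.toSeries : ℤ) : ZMod 4) = 0 := by
  have h1 := cast_coeff_commutator (e := 2 * t) (j := 1) (by omega) (by omega) hf hg (by omega)
  have h2 := coeff_commutator (j := 2) (by omega) hf hg (by omega)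
  rw [show 2 * (d + 2 * t + 1) + 1 = 3 * d + 3 by omega,
    ZMod.intCast_eq_intCast_iff_dvd_sub] at h1
  obtain ⟨y, hy⟩ := h1
  rw [show 2 * d + 1 + 2 = 2 * d + 3 by ring] at h2
  simp only [Finset.sum_range_succ, Finset.sum_range_zero, zero_add, add_zero, Nat.sub_zero,
    Nat.sub_self, Nat.cast_zero, Nat.cast_one, Nat.cast_ofNat, Nat.reduceSub] at h2 hy
  rw [show 2 * (2 * t) + 1 = d + 1 by omega, show 2 * (2 * t + 1) + 1 = d + 1 + 2 by omega] at hy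
  rw [h2]
  refine (ZMod.intCast_zmod_eq_zero_iff_dvd _ 4).2
    ⟨(1 + t) * (coeff (d + 1 + 2) f.toSeries * coeff (d + 1) g.toSeries -
      coeff (d + 1 + 2) g.toSeries * coeff (d + 1) f.toSeries) +
      t * (coeff (d + 1) f.toSeries * coeff (d + 1 + 1) g.toSeries -
      coeff (d + 1) g.toSeries * coeff (d + 1 + 1) f.toSeries) - y, ?_⟩
  push_cast at hy ⊢
  linear_combination -2 * hy

/-- In the Wronskian the outermost pair has factor 4 and the next has factor 2. Modulo four this
leaves twice the determinant of the coefficients of indices `d + 4` and `d + 2`, which is the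
coefficient of index `3 * d + 6` modulo two. -/
theorem cast_coeff_commutator_of_three_mod_four (hd : d = 4 * t + 3) (ht : 1 ≤ t)
    (hf : f ∈ filt ℤ d) (hg : g ∈ filt ℤ d) : ((coeff (2 * d + 5) ⁅f, g⁆.toSeries +
      2 * coeff (3 * d + 6) ⁅f, g⁆.toSeries : ℤ) : ZMod 4) = 0 := by
  have h1 := cast_coeff_commutator (e := 2 * t + 2) (j := 2) (by omega) (by omega) hf hg (by omega)
  have h2 := coeff_commutator (j := 4) (by omega) hf hg (by omega)
  rw [show 2 * (d + (2 * t + 2) + 2) + 1 = 3 * d + 6 by omega,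
    ZMod.intCast_eq_intCast_iff_dvd_sub] at h1
  obtain ⟨y, hy⟩ := h1
  rw [show 2 * d + 1 + 4 = 2 * d + 5 by ring] at h2
  simp only [Finset.sum_range_succ, Finset.sum_range_zero, zero_add, add_zero, Nat.sub_zero,
    Nat.sub_self, Nat.cast_zero, Nat.cast_one, Nat.cast_ofNat, Nat.reduceSub] at h2 hy
  rw [show 2 * (2 * t + 2) + 1 = d + 1 + 1 by omega,
    show 2 * (2 * t + 2 + 1) + 1 = d + 1 + 3 by omega,
    show 2 * (2 * t + 2 + 2) + 1 = d + 1 + 5 by omega] at hy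
  rw [h2]
  refine (ZMod.intCast_zmod_eq_zero_iff_dvd _ 4).2
    ⟨(coeff (d + 1 + 4) f.toSeries * coeff (d + 1) g.toSeries -
      coeff (d + 1 + 4) g.toSeries * coeff (d + 1) f.toSeries) +
      (t + 2) * (coeff (d + 1 + 3) f.toSeries * coeff (d + 1 + 1) g.toSeries -
      coeff (d + 1 + 3) g.toSeries * coeff (d + 1 + 1) f.toSeries) +
      (t + 1) * (coeff (d + 1 + 1) f.toSeries * coeff (d + 1 + 2) g.toSeries -
      coeff (d + 1 + 1) g.toSeries * coeff (d + 1 + 2) f.toSeries) +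
      (t + 2) * (coeff (d + 1 + 5) f.toSeries * coeff (d + 1) g.toSeries -
      coeff (d + 1 + 5) g.toSeries * coeff (d + 1) f.toSeries) - y, ?_⟩
  push_cast at hy ⊢
  linear_combination -2 * hy

end Vanishing

/-! ### Torsion in each residue class -/

theorem torsion_of_one_or_two_mod_four {d : ℕ} (hd : 4 ≤ d) (hd4 : d % 4 = 1 ∨ d % 4 = 2) :
    Nonempty (CommGroup.torsion (Abelianization (filt ℤ d)) ≃*
      Multiplicative (Fin ((d + 3) / 2) → ZMod 2)) := by
  refine nonempty_torsion_equiv hd (coeffsModTwo d ((d + 3) / 2) (by omega))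
    (coeffsModTwo_surjective _) ?_ ((Finset.range ((d + 3) / 2)).image fun i => 2 * d + 2 + 2 * i)
    (fun m hm hmL => ?_) ?_
  · rintro z ⟨f, hf, g, hg, hz⟩
    refine funext fun i => ?_
    change ((coeff (2 * d + 3 + 2 * i) z.1.toSeries +
      if i.1 = d / 2 then coeff (2 * d + 2) z.1.toSeries else 0 : ℤ) : ZMod 2) = 0
    rw [← hz]
    have hi := i.2
    rcases hd4 with h | h
    · exact cast_coeff_commutator_of_one_mod_four (t := d / 4) (by omega) (by omega) hf hg
        (by omega)
    · exact cast_coeff_commutator_of_odd (e := d / 2) (by omega)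
        (by rw [Nat.odd_iff]; omega) (by omega) hf hg (by omega)
  · have h : (m - 2 * d - 2) / 2 < (d + 3) / 2 → 2 * d + 2 + 2 * ((m - 2 * d - 2) / 2) ≠ m :=
      fun h1 h2 => hmL (Finset.mem_image.2 ⟨_, Finset.mem_range.2 h1, h2⟩)
    unfold Good
    omega
  · rw [Finset.card_image_of_injective _ (fun i j hij => by simpa using hij), Finset.card_range]
    simp

theorem card_zmod_four_prod (r : ℕ) : Nat.card (ZMod 4 × (Fin r → ZMod 2)) = 2 ^ (r + 2) := by
  simp [pow_add, mul_comm]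

/-- The exceptional depths run over the even numbers from `2 * d + 2` to `3 * d + 2`. The first and
last are joined into the factor `ZMod 4`. -/
theorem torsion_of_zero_mod_four {d : ℕ} (hd : 4 ≤ d) (hd4 : d % 4 = 0) :
    Nonempty (CommGroup.torsion (Abelianization (filt ℤ d)) ≃*
      Multiplicative (ZMod 4 × (Fin ((d - 2) / 2) → ZMod 2))) := by
  refine nonempty_torsion_equiv hd (coeffsModFour d (2 * d + 3) (3 * d + 3)
    (fun i => 2 * d + 5 + 2 * i) (by omega) (by omega) (fun i => by omega))
    (coeffsModFour_surjective _ _ _ (by omega) (by omega) (fun i => by omega) (by omega)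
      (fun i => by omega) (fun i => by omega) (fun i j hij => Fin.ext (by simpa using hij))) ?_
    ((Finset.range ((d + 2) / 2)).image fun i => 2 * d + 2 + 2 * i) (fun m hm hmL => ?_) ?_
  · rintro z ⟨f, hf, g, hg, hz⟩
    refine Prod.ext ?_ (funext fun i => ?_)
    · change ((coeff (2 * d + 3) z.1.toSeries + 2 * coeff (3 * d + 3) z.1.toSeries : ℤ) :
        ZMod 4) = 0
      rw [← hz]
      exact cast_coeff_commutator_of_zero_mod_four (t := d / 4) (by omega) (by omega) hf hg
    · change ((coeff (2 * d + 5 + 2 * i) z.1.toSeries : ℤ) : ZMod 2) = 0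
      have hi := i.2
      rw [← hz, show 2 * d + 5 + 2 * i.1 = 2 * (d + 2 + i) + 1 by ring]
      exact cast_coeff_commutator_eq_zero_of_le (e := d / 2) (by omega) (by omega)
        (by rw [Nat.even_iff]; omega) hf hg (by omega) (by omega)
  · have h : (m - 2 * d - 2) / 2 < (d + 2) / 2 → 2 * d + 2 + 2 * ((m - 2 * d - 2) / 2) ≠ m :=
      fun h1 h2 => hmL (Finset.mem_image.2 ⟨_, Finset.mem_range.2 h1, h2⟩)
    unfold Good
    omega
  · rw [Finset.card_image_of_injective _ (fun i j hij => by simpa using hij), Finset.card_range,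
      card_zmod_four_prod]
    congr 1
    omega

/-- Besides the even depths from `2 * d + 2` to `3 * d + 1` there is the isolated exceptional depth
`3 * d + 5`. It is joined with depth `2 * d + 4` into `ZMod 4`, which is why `τ` skips the index `2
* d + 5`. -/
theorem torsion_of_three_mod_four {d : ℕ} (hd : 4 ≤ d) (hd4 : d % 4 = 3) :
    Nonempty (CommGroup.torsion (Abelianization (filt ℤ d)) ≃*
      Multiplicative (ZMod 4 × (Fin ((d - 1) / 2) → ZMod 2))) := by
  have hτ : ∀ i : Fin ((d - 1) / 2), 2 * d + 3 ≤ (if i.1 = 0 then 2 * d + 3 else 2 * d + 5 + 2 * i)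
      ∧ (if i.1 = 0 then 2 * d + 3 else 2 * d + 5 + 2 * i) ≤ 3 * d + 2 ∧
      (if i.1 = 0 then 2 * d + 3 else 2 * d + 5 + 2 * i) ≠ 2 * d + 5 := by
    intro i
    have hi := i.2
    split_ifs <;> omega
  refine nonempty_torsion_equiv hd (coeffsModFour d (2 * d + 5) (3 * d + 6)
    (fun i : Fin ((d - 1) / 2) => if i.1 = 0 then 2 * d + 3 else 2 * d + 5 + 2 * i)
    (by omega) (by omega) (fun i => by have := hτ i; omega))
    (coeffsModFour_surjective _ _ _ (by omega) (by omega) (fun i => by have := hτ i; omega)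
      (by omega) (fun i => by have := hτ i; omega) (fun i => by have := hτ i; omega)
      (fun i j hij => Fin.ext (by
        split_ifs at hij <;> omega))) ?_
    (insert (3 * d + 5) ((Finset.range ((d + 1) / 2)).image fun i => 2 * d + 2 + 2 * i))
    (fun m hm hmL => ?_) ?_
  · rintro z ⟨f, hf, g, hg, hz⟩
    refine Prod.ext ?_ (funext fun i => ?_)
    · change ((coeff (2 * d + 5) z.1.toSeries + 2 * coeff (3 * d + 6) z.1.toSeries : ℤ) :
        ZMod 4) = 0
      rw [← hz]
      exact cast_coeff_commutator_of_three_mod_four (t := d / 4) (by omega) (by omega) hf hg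
    · change ((coeff (if i.1 = 0 then 2 * d + 3 else 2 * d + 5 + 2 * i) z.1.toSeries : ℤ) :
        ZMod 2) = 0
      have hi := hτ i
      obtain ⟨n, hn⟩ : ∃ n, (if i.1 = 0 then 2 * d + 3 else 2 * d + 5 + 2 * i.1) = 2 * n + 1 := by
        split_ifs
        · exact ⟨d + 1, by ring⟩
        · exact ⟨d + 2 + i, by ring⟩
      rw [hn] at hi ⊢
      rw [← hz]
      exact cast_coeff_commutator_eq_zero_of_le (e := (d + 1) / 2) (by omega) (by omega)
        (by rw [Nat.even_iff]; omega) hf hg (by omega) (by omega)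
  · rw [Finset.mem_insert, not_or] at hmL
    have h : (m - 2 * d - 2) / 2 < (d + 1) / 2 → 2 * d + 2 + 2 * ((m - 2 * d - 2) / 2) ≠ m :=
      fun h1 h2 => hmL.2 (Finset.mem_image.2 ⟨_, Finset.mem_range.2 h1, h2⟩)
    unfold Good
    omega
  · rw [Finset.card_insert_of_notMem, Finset.card_image_of_injective _
      (fun i j hij => by simpa using hij), Finset.card_range, card_zmod_four_prod]
    · congr 1
      omega
    · simp only [Finset.mem_image, Finset.mem_range]
      rintro ⟨i, hi, hi'⟩
      omega

end JenningsGroup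

theorem mainTheorem2 (k : ℕ) (hk : 5 ≤ k) :
    (k % 4 = 3 → Nonempty
      (CommGroup.torsion (Abelianization (JenningsGroup.level ℤ k)) ≃*
        Multiplicative (Fin ((k + 1) / 2) → ZMod 2))) ∧
    (k % 4 = 2 → Nonempty
      (CommGroup.torsion (Abelianization (JenningsGroup.level ℤ k)) ≃*
        Multiplicative (Fin ((k + 2) / 2) → ZMod 2))) ∧
    (k % 4 = 1 → Nonempty
      (CommGroup.torsion (Abelianization (JenningsGroup.level ℤ k)) ≃*
        Multiplicative (ZMod 4 × (Fin ((k - 3) / 2) → ZMod 2)))) ∧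
    (k % 4 = 0 → Nonempty
      (CommGroup.torsion (Abelianization (JenningsGroup.level ℤ k)) ≃*
        Multiplicative (ZMod 4 × (Fin ((k - 2) / 2) → ZMod 2)))) := by
  obtain ⟨d, rfl⟩ : ∃ d, k = d + 1 := ⟨k - 1, by omega⟩
  refine ⟨fun h => ?_, fun h => ?_, fun h => ?_, fun h => ?_⟩
  · rw [show (d + 1 + 1) / 2 = (d + 3) / 2 by omega]
    exact JenningsGroup.torsion_of_one_or_two_mod_four (by omega) (by omega)
  · exact JenningsGroup.torsion_of_one_or_two_mod_four (by omega) (by omega)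
  · rw [show (d + 1 - 3) / 2 = (d - 2) / 2 by omega]
    exact JenningsGroup.torsion_of_zero_mod_four (by omega) (by omega)
  · rw [show (d + 1 - 2) / 2 = (d - 1) / 2 by omega]
    exact JenningsGroup.torsion_of_three_mod_four (by omega) (by omega)
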